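/- Let $\beta\in(0,1)$ and let $(S_u)_{u\ge0}$ be a $\beta$-stable subordinator on a probability space, i.e. a Lévy process with almost surely nondecreasing right-continuous paths and $\mathbb E[e^{-\lambda S_u}]=e^{-u\lambda^\beta}$ for all $u,\lambda\ge0$. Let $Z_t=\inf\{s\ge0: S_s>t\}$ be its inverse, and put $p(t,u)=\partial_u\mathbb P[Z_t\le u]$ (with $p(t,0):=0$). For a function $h$, let $$\mathbb D_t^\beta h(t)=\frac1{\Gamma(1-\beta)}\frac{d}{dt}\int_0^t h(t-r)\,r^{-\beta}\,dr$$ be its Riemann–Liouville derivative. Then for every fixed $t>0$: 1. $u\mapsto\mathbb P[Z_t\le u]$ is differentiable at every $u>0$, and the law of $Z_t$ has density $p(t,\cdot)$ with respect to Lebesgue measure on $\mathbb R$. 2. The equation $$(\mathbb D_t^\beta+\partial_u)\,p(t,u)=\frac{t^{-\beta}}{\Gamma(1-\beta)}\,\delta(u)$$ holds in the sense of distributions in $u\in\mathbb R$, where $\delta$ is the Dirac mass at $0$. Namely, $\mathbb D_t^\beta p(t,u)$ (with $u$ fixed) exists for every $u>0$, the function $u\mapsto \mathbb D_t^\beta p(t,u)$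 is locally integrable on $\mathbb R$, and for every $\varphi\in C_c^\infty(\mathbb R)$ $$\int_{\mathbb R}\mathbb D_t^\beta p(t,u)\,\varphi(u)\,du-\int_{\mathbb R}p(t,u)\,\varphi'(u)\,du=\frac{t^{-\beta}}{\Gamma(1-\beta)}\,\varphi(0).$$ The same equation also holds when $\mathbb D_t^\beta$ is applied to the distribution-valued map $s\mapsto p(s,\cdot)$: for every $\varphi\in C_c^\infty(\mathbb R)$ the function $s\mapsto\int_{\mathbb R}p(s,u)\varphi(u)\,du$ has a Riemann–Liouville derivative at $t$, and $$\mathbb D_t^\beta\Big[\int_{\mathbb R}p(\cdot,u)\,\varphi(u)\,du\Big](t)-\int_{\mathbb R}p(t,u)\,\varphi'(u)\,du=\frac{t^{-\beta}}{\Gamma(1-\beta)}\,\varphi(0).$$ -/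

import Mathlib

open MeasureTheory ProbabilityTheory Filter Topology
open scoped NNReal

noncomputable section

/-- `S = (S_u)_{u ≥ 0}` is a `β`-stable subordinator under `P`: a real Lévy process with almost
surely nondecreasing right-continuous paths (left limits are then automatic), normalised by the
Laplace transform `E[exp (-l S_u)] = exp (-u l^β)` for `l ≥ 0`. -/
structure IsStableSubordinator {Ω : Type*} [MeasurableSpace Ω] (β : ℝ) (S : ℝ≥0 → Ω → ℝ)
    (P : Measure Ω) : Prop where
  measurable : ∀ u, Measurable (S u)
  zero : ∀ᵐ ω ∂P, S 0 ω = 0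
  indep_increments : HasIndepIncrements S P
  stationary_increments : ∀ s u : ℝ≥0, IdentDistrib (fun ω => S (s + u) ω - S s ω) (S u) P P
  monotone_paths : ∀ᵐ ω ∂P, Monotone fun u => S u ω
  right_continuous_paths : ∀ᵐ ω ∂P, ∀ u, ContinuousWithinAt (fun v => S v ω) (Set.Ici u) u
  laplace : ∀ (u : ℝ≥0) (l : ℝ), 0 ≤ l →
    ∫ ω, Real.exp (-(l * S u ω)) ∂P = Real.exp (-((u : ℝ) * l ^ β))

/-- The inverse process `Z_t = inf {s ≥ 0 : S_s > t}`. -/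
def inverseProcess {Ω : Type*} (S : ℝ≥0 → Ω → ℝ) (t : ℝ) (ω : Ω) : ℝ :=
  ((sInf {s : ℝ≥0 | t < S s ω} : ℝ≥0) : ℝ)

/-- `p_Z(t, u) = ∂_u P[Z_t ≤ u]`. -/
def inverseDensity {Ω : Type*} [MeasurableSpace Ω] (P : Measure Ω) (S : ℝ≥0 → Ω → ℝ)
    (t u : ℝ) : ℝ :=
  deriv (fun v : ℝ => P.real {ω | inverseProcess S t ω ≤ v}) u

/-- The fractional integral `Γ(1-β)⁻¹ ∫_0^t h(t-r) r^{-β} dr`. -/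
def rlIntegral (β : ℝ) (h : ℝ → ℝ) (t : ℝ) : ℝ :=
  1 / Real.Gamma (1 - β) * ∫ r in (0 : ℝ)..t, h (t - r) * r ^ (-β)

/-- The Riemann–Liouville derivative `D^β h (t)`. -/
def rlDeriv (β : ℝ) (h : ℝ → ℝ) (t : ℝ) : ℝ :=
  deriv (rlIntegral β h) t

/-- The Riemann–Liouville derivative of `h` exists at `t`: the integrals defining it converge
near `t`, and the resulting function is differentiable at `t`. -/
def RLDifferentiableAt (β : ℝ) (h : ℝ → ℝ) (t : ℝ) : Prop :=
  (∀ᶠ s in 𝓝 t, IntervalIntegrable (fun r => h (s - r) * r ^ (-β)) volume 0 s) ∧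
    DifferentiableAt ℝ (rlIntegral β h) t

/-- Real test functions on the line: smooth with compact support. -/
def IsTestFunction (φ : ℝ → ℝ) : Prop :=
  ContDiff ℝ ((⊤ : ℕ∞) : WithTop ℕ∞) φ ∧ HasCompactSupport φ

end

/-! Monotone right-continuous paths give `Z_t ≤ v` iff `S_v > t` up to null sets, and uniqueness of
Laplace transforms gives the scaling `S_v = v^(1/β) S_1` in law. So `P[Z_t ≤ v] = 1 - F(t v^(-1/β))`
with `F` the distribution function of `S_1`, and everything reduces to an explicit density for
`S_1`.

The characteristic function of `S_1` is the boundary value of `exp (-w^β)` on the imaginary axis. It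
is integrable, so Fourier inversion gives the density as the real part of an oscillatory integral.
Moving that integral to the positive real axis (`stretchedLaplace_one_mul_I`, proved by real
scaling, analytic continuation and a boundary limit instead of a contour rotation) and integrating
by parts once produces `β x^(-1-β) M(x^(-β))`, with `M` the Mainardi function. Hence `p(t,u) =
t^(-β) M(u t^(-β))` for `t, u > 0`, and the reflection formula gives `M(0) = 1/Γ(1-β)`.

For `u > 0` the equation is the pointwise identity `D_t^β p = -∂_u p`. The law of `S_u` has density
`βu p(t,u)/t` in `t`, so the first two derivatives of `E[exp (-l S_u)]` in `l` are Laplace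
transforms of `p` and `t p`. Comparing them shows that `p(·,u)` convolved with `r^(-β)/Γ(1-β) +
(1-β)/(βu)` equals `t p/(βu)` (`convolution_eq`). The fractional integral of `p` is therefore `t
p/(βu)` minus a multiple of the ordinary primitive of `p`. Its derivative is elementary, and the
terms in `p` cancel, leaving `-t^(-2β) M'(u t^(-β)) = -∂_u p`.

The Dirac mass is the boundary term `p(t,0+) = t^(-β) M(0)` of an integration by parts over `u > 0`.
For the distribution-valued form, Fubini exchanges the fractional integral with the pairing, and
compactness of the support of `φ` allows differentiation under the integral. -/

/-! ### Laplace transforms: analytic continuation, uniqueness, boundary values -/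

/-- Holomorphic functions on the right half-plane that agree on the positive reals are equal. -/
theorem eq_of_eq_ofReal_of_re_pos {f g : ℂ → ℂ} (hf : DifferentiableOn ℂ f {w | 0 < w.re})
    (hg : DifferentiableOn ℂ g {w | 0 < w.re}) (h : ∀ l : ℝ, 0 < l → f l = g l) {w : ℂ}
    (hw : 0 < w.re) : f w = g w := by
  have ho : IsOpen {w : ℂ | 0 < w.re} := isOpen_lt continuous_const Complex.continuous_re
  have hc : IsPreconnected {w : ℂ | 0 < w.re} := (convex_halfSpace_re_gt 0).isPreconnected
  refine (hf.analyticOnNhd ho).eqOn_of_preconnected_of_frequently_eq (z₀ := ((1 : ℝ) : ℂ))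
    (hg.analyticOnNhd ho) hc (by simp) ?_ hw
  rw [frequently_iff]
  intro U hU
  have h1 : Tendsto (fun x : ℝ => (x : ℂ)) (𝓝[≠] 1) (𝓝[≠] ((1 : ℝ) : ℂ)) := by
    refine tendsto_nhdsWithin_of_tendsto_nhds_of_eventually_within _ ?_ ?_
    · exact (Complex.continuous_ofReal.tendsto 1).mono_left nhdsWithin_le_nhds
    · filter_upwards [self_mem_nhdsWithin] with x hx
      simpa using hx
  have h2 : ∀ᶠ x : ℝ in 𝓝[≠] 1, 0 < x := nhdsWithin_le_nhds (lt_mem_nhds one_pos)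
  obtain ⟨x, hx, hx0⟩ := ((h1.eventually hU).and h2).exists
  exact ⟨x, hx, h x hx0⟩

theorem mem_interior_integrableExpSet_of_neg {ν : Measure ℝ}
    (hν : ∀ l : ℝ, 0 < l → Integrable (fun x => Real.exp (-(l * x))) ν) {s : ℝ} (hs : s < 0) :
    s ∈ interior (integrableExpSet id ν) := by
  have : Set.Iio (0 : ℝ) ⊆ integrableExpSet id ν := by
    intro x hx
    have := hν (-x) (by simpa using hx)
    simpa [integrableExpSet] using this
  exact interior_mono this (by simpa using hs)

theorem complexMGF_neg_ofReal {ν : Measure ℝ} (l : ℝ) :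
    complexMGF id ν (-(l : ℂ)) = ((∫ x, Real.exp (-(l * x)) ∂ν : ℝ) : ℂ) := by
  rw [← Complex.ofReal_neg, complexMGF_ofReal]
  simp [mgf]

theorem differentiableOn_complexMGF_neg {ν : Measure ℝ}
    (hν : ∀ l : ℝ, 0 < l → Integrable (fun x => Real.exp (-(l * x))) ν) :
    DifferentiableOn ℂ (fun w => complexMGF id ν (-w)) {w | 0 < w.re} := by
  intro w hw
  have hw' : 0 < w.re := hw
  have := (hasDerivAt_complexMGF (X := id) (μ := ν) (z := -w)
    (mem_interior_integrableExpSet_of_neg hν (by simpa using hw'))).differentiableAt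
  exact (this.comp w differentiableAt_id.neg).differentiableWithinAt

/-- Uniqueness of the Laplace transform. -/
theorem MeasureTheory.Measure.ext_of_laplace {ν₁ ν₂ : Measure ℝ}
    (h₁ : ∀ l : ℝ, 0 < l → Integrable (fun x => Real.exp (-(l * x))) ν₁)
    (h₂ : ∀ l : ℝ, 0 < l → Integrable (fun x => Real.exp (-(l * x))) ν₂)
    (h : ∀ l : ℝ, 0 < l →
      ∫ x, Real.exp (-(l * x)) ∂ν₁ = ∫ x, Real.exp (-(l * x)) ∂ν₂) : ν₁ = ν₂ := by
  have key : ∀ w : ℂ, 0 < w.re → complexMGF id ν₁ (-w) = complexMGF id ν₂ (-w) := by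
    intro w hw
    refine eq_of_eq_ofReal_of_re_pos (differentiableOn_complexMGF_neg h₁)
      (differentiableOn_complexMGF_neg h₂) ?_ hw
    intro l hl
    simp only [complexMGF_neg_ofReal, h l hl]
  -- The measures may be infinite, as they are in `convolution_eq`. Tilting by `exp (-x)` makes them
  -- finite, and the characteristic function of the tilted measure is the Laplace transform along
  -- the line `Re w = 1`.
  let ρ : ℝ → ENNReal := fun x => ENNReal.ofReal (Real.exp (-(1 * x)))
  have hρ : Measurable ρ := by fun_prop
  have hfin : ∀ ν : Measure ℝ, Integrable (fun x => Real.exp (-(1 * x))) ν →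
      IsFiniteMeasure (ν.withDensity ρ) := fun ν hν => isFiniteMeasure_withDensity_ofReal hν.2
  have hchar : ∀ (ν : Measure ℝ) (ξ : ℝ),
      charFun (ν.withDensity ρ) ξ = complexMGF id ν (-(1 - ξ * Complex.I)) := by
    intro ν ξ
    rw [charFun_apply_real, integral_withDensity_eq_integral_toReal_smul hρ
      (ae_of_all _ fun _ => ENNReal.ofReal_lt_top)]
    refine integral_congr_ae (ae_of_all _ fun x => ?_)
    simp only [ρ, ENNReal.toReal_ofReal (Real.exp_pos _).le, Complex.real_smul, id,
      Complex.ofReal_exp, ← Complex.exp_add]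
    congr 1
    push_cast
    ring
  have := hfin ν₁ (h₁ 1 one_pos)
  have := hfin ν₂ (h₂ 1 one_pos)
  have heq : ν₁.withDensity ρ = ν₂.withDensity ρ := by
    refine Measure.ext_of_charFun (funext fun ξ => ?_)
    rw [hchar, hchar, key _ (by simp)]
  have hinv : ∀ ν : Measure ℝ, (ν.withDensity ρ).withDensity ρ⁻¹ = ν := fun ν =>
    withDensity_inv_same hρ (ae_of_all _ fun x => by simp [ρ, Real.exp_pos])
      (ae_of_all _ fun x => ENNReal.ofReal_ne_top)
  rw [← hinv ν₁, heq, hinv]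

/-- The characteristic function as the boundary value of the Laplace transform. -/
theorem charFun_eq_of_laplace {ν : Measure ℝ} [IsFiniteMeasure ν] (hν0 : ∀ᵐ x ∂ν, 0 ≤ x)
    {G : ℂ → ℂ} (hG : DifferentiableOn ℂ G {w | 0 < w.re})
    (h : ∀ l : ℝ, 0 < l → ((∫ x, Real.exp (-(l * x)) ∂ν : ℝ) : ℂ) = G l) {ξ : ℝ}
    (hc : ContinuousAt G (-(ξ * Complex.I))) : charFun ν ξ = G (-(ξ * Complex.I)) := by
  have hint : ∀ l : ℝ, 0 < l → Integrable (fun x => Real.exp (-(l * x))) ν := by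
    intro l hl
    refine (integrable_const (1 : ℝ)).mono' (by fun_prop) ?_
    filter_upwards [hν0] with x hx
    rw [Real.norm_eq_abs, abs_of_pos (Real.exp_pos _), Real.exp_le_one_iff]
    nlinarith
  have key : ∀ w : ℂ, 0 < w.re → complexMGF id ν (-w) = G w := fun w hw =>
    eq_of_eq_ofReal_of_re_pos (differentiableOn_complexMGF_neg hint) hG
      (fun l hl => by rw [complexMGF_neg_ofReal, h l hl]) hw
  -- The imaginary axis is approached from inside the half-plane; there `|exp (-w x)| ≤ 1` for `x ≥
  -- 0`, which dominates the integrals.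
  have hlim : Tendsto (fun e : ℝ => (e : ℂ) - ξ * Complex.I) (𝓝[>] 0)
      (𝓝 (-(ξ * Complex.I))) := by
    have : Tendsto (fun e : ℝ => (e : ℂ) - ξ * Complex.I) (𝓝 0)
        (𝓝 (((0 : ℝ) : ℂ) - ξ * Complex.I)) :=
      (Continuous.tendsto (by fun_prop) _)
    simpa using this.mono_left nhdsWithin_le_nhds
  have h1 : Tendsto (fun e : ℝ => complexMGF id ν (-((e : ℂ) - ξ * Complex.I))) (𝓝[>] 0)
      (𝓝 (G (-(ξ * Complex.I)))) := by
    refine (hc.tendsto.comp hlim).congr' ?_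
    filter_upwards [self_mem_nhdsWithin] with e he
    exact (key _ (by simpa using he)).symm
  refine tendsto_nhds_unique ?_ h1
  rw [charFun_apply_real]
  unfold complexMGF
  refine tendsto_integral_filter_of_dominated_convergence (fun _ => 1) ?_ ?_
    (integrable_const _) ?_
  · exact Eventually.of_forall fun e => by
      exact Continuous.aestronglyMeasurable (by fun_prop)
  · filter_upwards [self_mem_nhdsWithin] with e he
    filter_upwards [hν0] with x hx
    have : (0 : ℝ) < e := he
    rw [Complex.norm_exp, Real.exp_le_one_iff]
    simp
    nlinarith
  · refine ae_of_all _ fun x => ?_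
    have : Tendsto (fun e : ℝ => Complex.exp (-((e : ℂ) - ξ * Complex.I) * (id x : ℝ))) (𝓝 0)
        (𝓝 (Complex.exp (-(((0 : ℝ) : ℂ) - ξ * Complex.I) * (id x : ℝ)))) :=
      (Continuous.tendsto (by fun_prop) _)
    convert this.mono_left (nhdsWithin_le_nhds (s := Set.Ioi 0)) using 2
    congr 1
    simp only [id, Complex.ofReal_zero]
    ring

/-! ### Fourier inversion for finite measures with integrable characteristic function -/

open scoped FourierTransform SchwartzMap in
-- Write `f` as the Fourier transform of its inverse transform, move the transform onto `ν` by
-- Fubini, where it becomes the characteristic function, and then move the transform of `f` back by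
-- Fubini against Lebesgue measure.
theorem integral_schwartz_eq_of_integrable_charFun {ν : Measure ℝ} [IsFiniteMeasure ν]
    (hν : Integrable (charFun ν)) (f : 𝓢(ℝ, ℂ)) :
    ∫ x, f x ∂ν = ∫ x, f x * 𝓕 (fun ξ : ℝ => charFun ν (2 * Real.pi * ξ)) x := by
  have hχ : Integrable (fun ξ : ℝ => charFun ν (2 * Real.pi * ξ)) :=
    hν.comp_mul_left' (by positivity)
  have hf : ∀ x, f x = 𝓕 (𝓕⁻ (f : ℝ → ℂ)) x := fun x => by
    rw [← SchwartzMap.fourierInv_coe, ← SchwartzMap.fourier_coe,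
      FourierTransform.fourier_fourierInv_eq]
  have e1 := VectorFourier.integral_fourierIntegral_smul_eq_flip (μ := volume) (ν := ν)
    (L := innerₗ ℝ) (f := (𝓕⁻ (f : ℝ → ℂ))) (g := fun _ => (1 : ℂ)) Real.continuous_fourierChar
    continuous_inner (by rw [← SchwartzMap.fourierInv_coe]; exact SchwartzMap.integrable _)
    (integrable_const _)
  have e2 := VectorFourier.integral_fourierIntegral_smul_eq_flip (μ := volume) (ν := volume)
    (L := innerₗ ℝ) (f := f) (g := fun ξ : ℝ => charFun ν (2 * Real.pi * ξ))
    Real.continuous_fourierChar continuous_inner f.integrable hχ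
  have e3 : ∀ x : ℝ, VectorFourier.fourierIntegral Real.fourierChar ν (innerₗ ℝ).flip
      (fun _ => (1 : ℂ)) x = charFun ν (2 * Real.pi * (-x)) := fun x => by
    rw [charFun_apply_real]
    simp only [VectorFourier.fourierIntegral, Real.fourierChar_apply, Circle.smul_def]
    refine integral_congr_ae (ae_of_all _ fun y => ?_)
    simp
    ring_nf
  calc ∫ x, f x ∂ν = ∫ x, 𝓕 (𝓕⁻ (f : ℝ → ℂ)) x • (1 : ℂ) ∂ν :=
        integral_congr_ae (ae_of_all _ fun x => by simpa using hf x)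
    _ = ∫ x, (𝓕⁻ (f : ℝ → ℂ)) x * charFun ν (2 * Real.pi * (-x)) := by
        refine Eq.trans e1 ?_
        simp only [e3, smul_eq_mul]
    _ = ∫ x, 𝓕 (f : ℝ → ℂ) (-x) * charFun ν (2 * Real.pi * (-x)) := by
        simp only [Real.fourierInv_eq_fourier_neg]
    _ = ∫ x, 𝓕 (f : ℝ → ℂ) x * charFun ν (2 * Real.pi * x) :=
        integral_neg_eq_self (fun x => 𝓕 (f : ℝ → ℂ) x * charFun ν (2 * Real.pi * x)) volume
    _ = _ := by
        simp only [smul_eq_mul, flip_innerₗ] at e2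
        exact e2

open scoped FourierTransform in
theorem measureReal_Ioo_eq_of_integrable_charFun {ν : Measure ℝ} [IsFiniteMeasure ν]
    (hν : Integrable (charFun ν)) (a b : ℝ) :
    (ν.real (Set.Ioo a b) : ℂ) =
      ∫ x in Set.Ioo a b, 𝓕 (fun ξ : ℝ => charFun ν (2 * Real.pi * ξ)) x := by
  have hχ : Integrable (fun ξ : ℝ => charFun ν (2 * Real.pi * ξ)) :=
    hν.comp_mul_left' (by positivity)
  set g := 𝓕 (fun ξ : ℝ => charFun ν (2 * Real.pi * ξ)) with hg
  have hgc : Continuous g := VectorFourier.fourierIntegral_continuous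
    Real.continuous_fourierChar continuous_inner hχ
  -- Smooth bumps supported in `[a, b]`, bounded by the indicator of the open interval and at each
  -- of its points eventually equal to `1`. They transfer the identity for Schwartz functions to
  -- indicators.
  let f : ℕ → ℝ → ℝ := fun n x =>
    Real.smoothTransition (n * (x - a)) * Real.smoothTransition (n * (b - x))
  have hf0 : ∀ n x, x ∉ Set.Ioo a b → f n x = 0 := by
    intro n x hx
    rw [Set.mem_Ioo, not_and_or, not_lt, not_lt] at hx
    rcases hx with hx | hx
    · have : Real.smoothTransition (n * (x - a)) = 0 :=
        Real.smoothTransition.zero_of_nonpos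
          (mul_nonpos_of_nonneg_of_nonpos n.cast_nonneg (by linarith))
      simp [f, this]
    · have : Real.smoothTransition (n * (b - x)) = 0 :=
        Real.smoothTransition.zero_of_nonpos
          (mul_nonpos_of_nonneg_of_nonpos n.cast_nonneg (by linarith))
      simp [f, this]
  have hfs : ∀ n, ContDiff ℝ ((⊤ : ℕ∞) : WithTop ℕ∞) (f n) := fun n => by
    refine ContDiff.mul ?_ ?_ <;>
    exact Real.smoothTransition.contDiff.comp (by fun_prop)
  have hfcs : ∀ n, HasCompactSupport (fun x => (f n x : ℂ)) := fun n =>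
    HasCompactSupport.intro (K := Set.Icc a b) isCompact_Icc fun x hx => by
      rw [hf0 n x (fun h => hx (Set.Ioo_subset_Icc_self h)), Complex.ofReal_zero]
  have hfb : ∀ n x, ‖(f n x : ℂ)‖ ≤ (Set.Ioo a b).indicator (fun _ => (1 : ℝ)) x := by
    intro n x
    rw [Complex.norm_real, Real.norm_eq_abs]
    by_cases hx : x ∈ Set.Ioo a b
    · rw [Set.indicator_of_mem hx, abs_of_nonneg (mul_nonneg (Real.smoothTransition.nonneg _)
        (Real.smoothTransition.nonneg _))]
      exact mul_le_one₀ (Real.smoothTransition.le_one _) (Real.smoothTransition.nonneg _)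
        (Real.smoothTransition.le_one _)
    · rw [Set.indicator_of_notMem hx, hf0 n x hx, abs_zero]
  have hlim : ∀ x, Tendsto (fun n => (f n x : ℂ)) atTop
      (𝓝 ((Set.Ioo a b).indicator (fun _ => (1 : ℂ)) x)) := by
    intro x
    by_cases hx : x ∈ Set.Ioo a b
    · rw [Set.indicator_of_mem hx]
      refine tendsto_const_nhds.congr' ?_
      have h1 : Tendsto (fun n : ℕ => (n : ℝ) * (x - a)) atTop atTop :=
        tendsto_natCast_atTop_atTop.atTop_mul_const (sub_pos.2 hx.1)
      have h2 : Tendsto (fun n : ℕ => (n : ℝ) * (b - x)) atTop atTop :=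
        tendsto_natCast_atTop_atTop.atTop_mul_const (sub_pos.2 hx.2)
      filter_upwards [h1.eventually_ge_atTop 1, h2.eventually_ge_atTop 1] with n hn1 hn2
      simp [f, Real.smoothTransition.one_of_one_le hn1, Real.smoothTransition.one_of_one_le hn2]
    · rw [Set.indicator_of_notMem hx]
      refine tendsto_const_nhds.congr fun n => ?_
      rw [hf0 n x hx, Complex.ofReal_zero]
  have heq : ∀ n, ∫ x, (f n x : ℂ) ∂ν = ∫ x, (f n x : ℂ) * g x := fun n =>
    integral_schwartz_eq_of_integrable_charFun hν
      ((hfcs n).toSchwartzMap (Complex.ofRealCLM.contDiff.comp (hfs n)))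
  have l1 : Tendsto (fun n => ∫ x, (f n x : ℂ) ∂ν) atTop (𝓝 (ν.real (Set.Ioo a b) : ℂ)) := by
    have : (ν.real (Set.Ioo a b) : ℂ) = ∫ x, (Set.Ioo a b).indicator (fun _ => (1 : ℂ)) x ∂ν := by
      rw [integral_indicator_const _ measurableSet_Ioo]
      simp
    rw [this]
    refine tendsto_integral_of_dominated_convergence _
      (fun n => (Complex.continuous_ofReal.comp (hfs n).continuous).aestronglyMeasurable)
      ((integrable_const (1 : ℝ)).indicator measurableSet_Ioo)
      (fun n => ae_of_all _ (hfb n)) (ae_of_all _ hlim)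
  have l2 : Tendsto (fun n => ∫ x, (f n x : ℂ) * g x) atTop
      (𝓝 (∫ x in Set.Ioo a b, g x)) := by
    rw [← integral_indicator measurableSet_Ioo]
    refine tendsto_integral_of_dominated_convergence
      ((Set.Ioo a b).indicator (fun x => ‖g x‖))
      (fun n => ((Complex.continuous_ofReal.comp (hfs n).continuous).mul hgc).aestronglyMeasurable)
      ?_ (fun n => ae_of_all _ fun x => ?_) (ae_of_all _ fun x => ?_)
    · rw [integrable_indicator_iff measurableSet_Ioo]
      exact (hgc.norm.integrableOn_Icc (a := a) (b := b)).mono_set Set.Ioo_subset_Icc_self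
    · rw [norm_mul]
      refine (mul_le_mul_of_nonneg_right (hfb n x) (norm_nonneg _)).trans (le_of_eq ?_)
      by_cases hx : x ∈ Set.Ioo a b <;> simp [hx]
    · have := (hlim x).mul_const (g x)
      convert this using 2
      by_cases hx : x ∈ Set.Ioo a b <;> simp [hx]
  simp only [heq] at l1
  exact tendsto_nhds_unique l1 l2

/-! ### The stretched Laplace integral and its scaling identity -/

/-- The integral `∫_0^∞ r^(γ-1) exp (-w r - a r^β) dr`. -/
noncomputable def stretchedLaplace (β γ : ℝ) (a w : ℂ) : ℂ :=
  ∫ r in Set.Ioi (0 : ℝ), ((r ^ (γ - 1) : ℝ) : ℂ) * Complex.exp (-(w * r) - a * (r ^ β : ℝ))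

/-- Sublinearity of `r^β` is what lets `a` be an arbitrary complex number as long as `Re w > 0`. The
threshold `R` is where `K r^β = ε r`. -/
theorem exists_mul_rpow_le_add {β : ℝ} (hβ0 : 0 < β) (hβ1 : β < 1) {K ε : ℝ} (hK : 0 ≤ K)
    (hε : 0 < ε) : ∃ C, ∀ r, 0 < r → K * r ^ β ≤ ε * r + C := by
  set R : ℝ := (K / ε) ^ (1 / (1 - β)) with hR
  have hR0 : 0 ≤ R := by positivity
  have h1β : 0 < 1 - β := by linarith
  have hRp : R ^ (1 - β) = K / ε := by
    rw [hR, ← Real.rpow_mul (by positivity), one_div_mul_cancel h1β.ne', Real.rpow_one]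
  refine ⟨K * R ^ β, fun r hr => ?_⟩
  rcases le_total r R with h | h
  · have := mul_le_mul_of_nonneg_left (Real.rpow_le_rpow hr.le h hβ0.le) hK
    nlinarith [mul_pos hε hr]
  · have h2 : K / ε ≤ r ^ (1 - β) := hRp ▸ Real.rpow_le_rpow hR0 h h1β.le
    have h3 : r = r ^ (1 - β) * r ^ β := by
      rw [← Real.rpow_add hr]; simp
    have h4 : K ≤ ε * r ^ (1 - β) := by
      rw [div_le_iff₀ hε] at h2; linarith
    have h5 : 0 ≤ K * R ^ β := by positivity
    have h6 : K * r ^ β ≤ ε * r ^ (1 - β) * r ^ β :=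
      mul_le_mul_of_nonneg_right h4 (by positivity)
    calc K * r ^ β ≤ ε * r ^ (1 - β) * r ^ β := h6
      _ = ε * r := by rw [mul_assoc, ← h3]
      _ ≤ _ := by linarith

theorem integrableOn_rpow_mul_exp_stretched {β : ℝ} (hβ0 : 0 < β) (hβ1 : β < 1) {γ δ K : ℝ}
    (hγ : 0 < γ) (hδ : 0 < δ) (hK : 0 ≤ K) :
    IntegrableOn (fun r : ℝ => r ^ (γ - 1) * Real.exp (-(δ * r) + K * r ^ β)) (Set.Ioi 0) := by
  obtain ⟨C, hC⟩ := exists_mul_rpow_le_add hβ0 hβ1 hK (half_pos hδ)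
  have h1 := (integrableOn_rpow_mul_exp_neg_mul_rpow (p := 1) (s := γ - 1) (b := δ / 2)
    (by linarith) one_pos (by positivity)).const_mul (Real.exp C)
  refine Integrable.mono' h1 ?_ ?_
  · refine Measurable.aestronglyMeasurable ?_
    fun_prop
  · filter_upwards [ae_restrict_mem measurableSet_Ioi] with r hr
    have hr : 0 < r := hr
    have h2 : 0 ≤ r ^ (γ - 1) := Real.rpow_nonneg hr.le _
    rw [Real.norm_eq_abs, abs_of_nonneg (by positivity), Real.rpow_one]
    calc r ^ (γ - 1) * Real.exp (-(δ * r) + K * r ^ β)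
        ≤ r ^ (γ - 1) * Real.exp (C + -(δ / 2) * r) := by
          refine mul_le_mul_of_nonneg_left (Real.exp_le_exp.2 ?_) h2
          linarith [hC r hr]
      _ = _ := by rw [Real.exp_add]; ring

theorem norm_stretched_integrand_le {β γ δ K : ℝ} {a w : ℂ} (hw : δ ≤ w.re) (ha : ‖a‖ ≤ K)
    {r : ℝ} (hr : 0 < r) :
    ‖((r ^ (γ - 1) : ℝ) : ℂ) * Complex.exp (-(w * r) - a * (r ^ β : ℝ))‖ ≤
      r ^ (γ - 1) * Real.exp (-(δ * r) + K * r ^ β) := by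
  have h2 : 0 ≤ r ^ (γ - 1) := Real.rpow_nonneg hr.le _
  have h3 : 0 ≤ r ^ β := Real.rpow_nonneg hr.le _
  rw [norm_mul, Complex.norm_real, Real.norm_eq_abs, abs_of_nonneg h2, Complex.norm_exp]
  gcongr
  have h4 : -a.re ≤ K := (neg_le_abs _).trans ((Complex.abs_re_le_norm a).trans ha)
  have h5 : (-(w * r) - a * (r ^ β : ℝ)).re = -(w.re * r) + (-a.re) * r ^ β := by
    simp only [Complex.sub_re, Complex.neg_re, Complex.re_mul_ofReal]; ring
  rw [h5]
  gcongr

theorem aestronglyMeasurable_stretched_integrand (β γ : ℝ) (a w : ℂ) (μ : Measure ℝ) :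
    AEStronglyMeasurable
      (fun r : ℝ => ((r ^ (γ - 1) : ℝ) : ℂ) * Complex.exp (-(w * r) - a * (r ^ β : ℝ))) μ := by
  refine Measurable.aestronglyMeasurable ?_
  fun_prop

theorem integrableOn_stretched_integrand {β : ℝ} (hβ0 : 0 < β) (hβ1 : β < 1) {γ : ℝ}
    (hγ : 0 < γ) (a : ℂ) {w : ℂ} (hw : 0 < w.re) :
    IntegrableOn
      (fun r : ℝ => ((r ^ (γ - 1) : ℝ) : ℂ) * Complex.exp (-(w * r) - a * (r ^ β : ℝ)))
      (Set.Ioi 0) :=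
  Integrable.mono' (integrableOn_rpow_mul_exp_stretched hβ0 hβ1 hγ hw (norm_nonneg a))
    (aestronglyMeasurable_stretched_integrand _ _ _ _ _)
    ((ae_restrict_mem measurableSet_Ioi).mono fun _ hr =>
      norm_stretched_integrand_le le_rfl le_rfl hr)

/-- Each derivative in `a` brings down a factor `r^β`; the parameter `γ` keeps the family closed
under both differentiations. -/
theorem hasDerivAt_stretchedLaplace_left {β : ℝ} (hβ0 : 0 < β) (hβ1 : β < 1) {γ : ℝ}
    (hγ : 0 < γ) (a : ℂ) {w : ℂ} (hw : 0 < w.re) :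
    HasDerivAt (fun a => stretchedLaplace β γ a w) (-stretchedLaplace β (γ + β) a w) a := by
  have key := hasDerivAt_integral_of_dominated_loc_of_deriv_le
    (μ := volume.restrict (Set.Ioi (0 : ℝ))) (𝕜 := ℂ) (x₀ := a) (s := Metric.ball a 1)
    (F := fun a (r : ℝ) => ((r ^ (γ - 1) : ℝ) : ℂ) * Complex.exp (-(w * r) - a * (r ^ β : ℝ)))
    (F' := fun a (r : ℝ) =>
      -(((r ^ (γ + β - 1) : ℝ) : ℂ) * Complex.exp (-(w * r) - a * (r ^ β : ℝ))))
    (bound := fun r => r ^ (γ + β - 1) * Real.exp (-(w.re * r) + (‖a‖ + 1) * r ^ β))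
    (Metric.ball_mem_nhds a one_pos)
    (Eventually.of_forall fun a => aestronglyMeasurable_stretched_integrand _ _ _ _ _)
    (integrableOn_stretched_integrand hβ0 hβ1 hγ a hw)
    (aestronglyMeasurable_stretched_integrand _ _ _ _ _).neg ?_
    (integrableOn_rpow_mul_exp_stretched hβ0 hβ1 (by linarith) hw (by positivity)) ?_
  · refine key.2.congr_deriv ?_
    simp only [stretchedLaplace, integral_neg]
  · filter_upwards [ae_restrict_mem measurableSet_Ioi] with r hr b hb
    rw [norm_neg]
    refine norm_stretched_integrand_le le_rfl ?_ hr
    have := norm_sub_norm_le b a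
    rw [Metric.mem_ball, dist_eq_norm] at hb
    linarith
  · filter_upwards [ae_restrict_mem measurableSet_Ioi] with r hr b _
    have hr : 0 < r := hr
    have h1 := ((((hasDerivAt_id b).mul_const ((r ^ β : ℝ) : ℂ)).const_sub
      (-(w * r))).cexp).const_mul ((r ^ (γ - 1) : ℝ) : ℂ)
    refine HasDerivAt.congr_deriv h1 ?_
    rw [show γ + β - 1 = (γ - 1) + β by ring, Real.rpow_add hr]
    push_cast
    simp only [id]
    ring

theorem hasDerivAt_stretchedLaplace_right {β : ℝ} (hβ0 : 0 < β) (hβ1 : β < 1) {γ : ℝ}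
    (hγ : 0 < γ) (a : ℂ) {w : ℂ} (hw : 0 < w.re) :
    HasDerivAt (fun w => stretchedLaplace β γ a w) (-stretchedLaplace β (γ + 1) a w) w := by
  have hball : ∀ v ∈ Metric.ball w (w.re / 2), w.re / 2 ≤ v.re := by
    intro v hv
    rw [Metric.mem_ball, dist_eq_norm] at hv
    have := (Complex.abs_re_le_norm (v - w)).trans hv.le
    rw [Complex.sub_re, abs_le] at this
    linarith [this.1]
  have key := hasDerivAt_integral_of_dominated_loc_of_deriv_le
    (μ := volume.restrict (Set.Ioi (0 : ℝ))) (𝕜 := ℂ) (x₀ := w)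
    (s := Metric.ball w (w.re / 2))
    (F := fun w (r : ℝ) => ((r ^ (γ - 1) : ℝ) : ℂ) * Complex.exp (-(w * r) - a * (r ^ β : ℝ)))
    (F' := fun w (r : ℝ) =>
      -(((r ^ (γ + 1 - 1) : ℝ) : ℂ) * Complex.exp (-(w * r) - a * (r ^ β : ℝ))))
    (bound := fun r => r ^ (γ + 1 - 1) * Real.exp (-(w.re / 2 * r) + ‖a‖ * r ^ β))
    (Metric.ball_mem_nhds w (by positivity))
    (Eventually.of_forall fun a => aestronglyMeasurable_stretched_integrand _ _ _ _ _)
    (integrableOn_stretched_integrand hβ0 hβ1 hγ a hw)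
    (aestronglyMeasurable_stretched_integrand _ _ _ _ _).neg ?_
    (integrableOn_rpow_mul_exp_stretched hβ0 hβ1 (by linarith) (by positivity)
      (by positivity)) ?_
  · refine key.2.congr_deriv ?_
    simp only [stretchedLaplace, integral_neg]
  · filter_upwards [ae_restrict_mem measurableSet_Ioi] with r hr b hb
    rw [norm_neg]
    exact norm_stretched_integrand_le (hball b hb) le_rfl hr
  · filter_upwards [ae_restrict_mem measurableSet_Ioi] with r hr b _
    have hr : 0 < r := hr
    have h1 := ((((hasDerivAt_id b).mul_const (r : ℂ)).neg.sub_const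
      (a * (r ^ β : ℝ))).cexp).const_mul ((r ^ (γ - 1) : ℝ) : ℂ)
    refine HasDerivAt.congr_deriv h1 ?_
    rw [show γ + 1 - 1 = (γ - 1) + 1 by ring, Real.rpow_add hr, Real.rpow_one]
    push_cast
    simp only [id, Pi.neg_apply]
    ring

theorem stretchedLaplace_zero_left {β γ : ℝ} (hγ : 0 < γ) :
    stretchedLaplace β γ 0 1 = Real.Gamma γ := by
  rw [Real.Gamma_eq_integral hγ, ← integral_complex_ofReal]
  unfold stretchedLaplace
  refine integral_congr_ae (ae_of_all _ fun r => ?_)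
  push_cast
  simp [mul_comm]

theorem stretchedLaplace_one_ofReal {β : ℝ} (a : ℂ) {l : ℝ} (hl : 0 < l) :
    stretchedLaplace β 1 a l = (l : ℂ)⁻¹ * stretchedLaplace β 1 (a * (l : ℂ) ^ (-(β : ℂ))) 1 := by
  have h := integral_comp_mul_left_Ioi
    (fun y : ℝ => Complex.exp (-(1 * (y : ℂ)) - a * (l : ℂ) ^ (-(β : ℂ)) * (y ^ β : ℝ))) 0 hl
  rw [mul_zero] at h
  unfold stretchedLaplace
  simp only [sub_self, Real.rpow_zero, Complex.ofReal_one, one_mul] at h ⊢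
  rw [← Complex.ofReal_inv, ← Complex.real_smul, ← h]
  refine setIntegral_congr_fun measurableSet_Ioi fun r hr => ?_
  have hr : 0 < r := hr
  have e1 : (l : ℂ) ^ (-(β : ℂ)) = ((l ^ (-β) : ℝ) : ℂ) := by
    rw [Complex.ofReal_cpow hl.le]; push_cast; rfl
  have e2 : l ^ (-β) * (l * r) ^ β = r ^ β := by
    rw [Real.mul_rpow hl.le hr.le, ← mul_assoc, ← Real.rpow_add hl]; simp
  simp only [e1, mul_assoc, ← Complex.ofReal_mul, e2]

/-- For real `w > 0` this is the substitution `r ↦ r / w`; both sides are holomorphic in `w`, so it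
persists on the half-plane. -/
theorem stretchedLaplace_one_eq {β : ℝ} (hβ0 : 0 < β) (hβ1 : β < 1) (a : ℂ) {w : ℂ}
    (hw : 0 < w.re) :
    stretchedLaplace β 1 a w = w⁻¹ * stretchedLaplace β 1 (a * w ^ (-(β : ℂ))) 1 := by
  refine eq_of_eq_ofReal_of_re_pos (f := fun w => stretchedLaplace β 1 a w)
    (g := fun w => w⁻¹ * stretchedLaplace β 1 (a * w ^ (-(β : ℂ))) 1)
    (fun v hv => ?_) (fun v hv => ?_) (fun l hl => stretchedLaplace_one_ofReal a hl) hw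
  · exact (hasDerivAt_stretchedLaplace_right hβ0 hβ1 one_pos a
      hv).differentiableAt.differentiableWithinAt
  · have hv : 0 < v.re := hv
    have hv0 : v ≠ 0 := by rintro rfl; simp at hv
    have h1 : DifferentiableAt ℂ (fun v : ℂ => a * v ^ (-(β : ℂ))) v :=
      (differentiableAt_id.cpow_const (Or.inl hv)).const_mul a
    have h2 := (hasDerivAt_stretchedLaplace_left hβ0 hβ1 one_pos (a * v ^ (-(β : ℂ)))
      (w := 1) (by simp)).differentiableAt.comp v h1
    exact ((differentiableAt_inv hv0).mul h2).differentiableWithinAt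

/-- The scaling identity on the imaginary axis. -/
theorem stretchedLaplace_one_mul_I {β : ℝ} (hβ0 : 0 < β) (hβ1 : β < 1) {a : ℂ} (ha : 0 < a.re)
    {x : ℝ} (hx : 0 < x) :
    stretchedLaplace β 1 a (-(x * Complex.I)) = (-(x * Complex.I))⁻¹ *
      stretchedLaplace β 1 (a * (-(x * Complex.I)) ^ (-(β : ℂ))) 1 := by
  have hlim : Tendsto (fun e : ℝ => (e : ℂ) - x * Complex.I) (𝓝[>] 0)
      (𝓝 (-(x * Complex.I))) := by
    have : Tendsto (fun e : ℝ => (e : ℂ) - x * Complex.I) (𝓝 0)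
        (𝓝 (((0 : ℝ) : ℂ) - x * Complex.I)) :=
      (Continuous.tendsto (by fun_prop) _)
    simpa using this.mono_left nhdsWithin_le_nhds
  have hslit : -(x * Complex.I) ∈ Complex.slitPlane := Or.inr (by simpa using hx.ne')
  have hR : ContinuousAt (fun w : ℂ => w⁻¹ * stretchedLaplace β 1 (a * w ^ (-(β : ℂ))) 1)
      (-(x * Complex.I)) := by
    refine (continuousAt_inv₀ (Complex.slitPlane_ne_zero hslit)).mul ?_
    exact ContinuousAt.comp (f := fun w : ℂ => a * w ^ (-(β : ℂ)))
      (hasDerivAt_stretchedLaplace_left hβ0 hβ1 one_pos _ (w := 1) (by simp)).continuousAt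
      ((continuousAt_id.cpow continuousAt_const hslit).const_mul a)
  have h1 : Tendsto (fun e : ℝ => stretchedLaplace β 1 a ((e : ℂ) - x * Complex.I)) (𝓝[>] 0)
      (𝓝 ((-(x * Complex.I))⁻¹ *
        stretchedLaplace β 1 (a * (-(x * Complex.I)) ^ (-(β : ℂ))) 1)) := by
    refine (hR.tendsto.comp hlim).congr' ?_
    filter_upwards [self_mem_nhdsWithin] with e he
    exact (stretchedLaplace_one_eq hβ0 hβ1 a (by simpa using he)).symm
  refine tendsto_nhds_unique ?_ h1
  unfold stretchedLaplace
  -- On the imaginary axis `exp (-w r)` gives no decay; the domination uniform in `e > 0` comes from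
  -- `Re a > 0`.
  refine tendsto_integral_filter_of_dominated_convergence
    (fun r => r ^ (0 : ℝ) * Real.exp (-a.re * r ^ β)) ?_ ?_
    (integrableOn_rpow_mul_exp_neg_mul_rpow (by norm_num) hβ0 ha) ?_
  · exact Eventually.of_forall fun e => aestronglyMeasurable_stretched_integrand _ _ _ _ _
  · filter_upwards [self_mem_nhdsWithin] with e he
    filter_upwards [ae_restrict_mem measurableSet_Ioi] with r hr
    have he : 0 < e := he
    have hr : 0 < r := hr
    rw [norm_mul, Complex.norm_exp, sub_self, Real.rpow_zero, Complex.ofReal_one, norm_one]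
    gcongr
    have h5 : (-(((e : ℂ) - x * Complex.I) * r) - a * (r ^ β : ℝ)).re
        = -(e * r) + (-a.re) * r ^ β := by
      simp only [Complex.sub_re, Complex.neg_re, Complex.ofReal_re,
        Complex.I_re, Complex.mul_re, Complex.ofReal_im, Complex.I_im]
      ring
    rw [h5]
    nlinarith
  · refine ae_of_all _ fun r => ?_
    have : Continuous fun w : ℂ =>
        ((r ^ ((1 : ℝ) - 1) : ℝ) : ℂ) * Complex.exp (-(w * r) - a * (r ^ β : ℝ)) := by
      fun_prop
    exact (this.tendsto _).comp hlim

/-- Integrate the derivative of `exp (-r - a r^β)` over the half-line: the boundary values are `1`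
at zero and `0` at infinity. -/
theorem stretchedLaplace_one_one {β : ℝ} (hβ0 : 0 < β) (hβ1 : β < 1) (a : ℂ) :
    stretchedLaplace β 1 a 1 = 1 - β * a * stretchedLaplace β β a 1 := by
  have h0 : (0 : ℝ) < (1 : ℂ).re := by simp
  have i1 := integrableOn_stretched_integrand hβ0 hβ1 one_pos a h0
  have i2 := integrableOn_stretched_integrand hβ0 hβ1 hβ0 a h0
  have key := integral_Ioi_of_hasDerivAt_of_tendsto (a := (0 : ℝ))
    (f := fun r : ℝ => Complex.exp (-(1 * (r : ℂ)) - a * (r ^ β : ℝ)))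
    (f' := fun r : ℝ =>
      -(((r ^ ((1 : ℝ) - 1) : ℝ) : ℂ) * Complex.exp (-(1 * (r : ℂ)) - a * (r ^ β : ℝ)))
      - β * a * (((r ^ (β - 1) : ℝ) : ℂ) * Complex.exp (-(1 * (r : ℂ)) - a * (r ^ β : ℝ))))
    (m := 0) ?_ ?_ (i1.neg.sub (i2.const_mul _)) ?_
  · rw [integral_sub (f := fun r : ℝ => -(((r ^ ((1 : ℝ) - 1) : ℝ) : ℂ) *
      Complex.exp (-(1 * (r : ℂ)) - a * (r ^ β : ℝ)))) i1.neg (i2.const_mul _), integral_neg,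
      integral_const_mul] at key
    change -stretchedLaplace β 1 a 1 - β * a * stretchedLaplace β β a 1 = _ at key
    rw [Real.zero_rpow hβ0.ne'] at key
    simp only [Complex.ofReal_zero, mul_zero, neg_zero, sub_zero, Complex.exp_zero, zero_sub]
      at key
    linear_combination -key
  · have : Continuous fun r : ℝ => Complex.exp (-(1 * (r : ℂ)) - a * (r ^ β : ℝ)) := by
      have := Real.continuous_rpow_const hβ0.le
      fun_prop
    exact this.continuousWithinAt
  · intro r hr
    have hr : 0 < r := hr
    have h1 : HasDerivAt (fun r : ℝ => ((r ^ β : ℝ) : ℂ)) ((β * r ^ (β - 1) : ℝ) : ℂ) r :=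
      (Real.hasDerivAt_rpow_const (Or.inl hr.ne')).ofReal_comp
    have h2 : HasDerivAt (fun r : ℝ => (r : ℂ)) 1 r := (hasDerivAt_id r).ofReal_comp
    have h3 := ((h2.const_mul 1).neg.sub (h1.const_mul a)).cexp
    refine HasDerivAt.congr_deriv h3 ?_
    simp only [sub_self, Real.rpow_zero, Pi.sub_apply, Pi.neg_apply]
    push_cast
    ring
  · rw [tendsto_zero_iff_norm_tendsto_zero]
    obtain ⟨C, hC⟩ := exists_mul_rpow_le_add hβ0 hβ1 (norm_nonneg a) (half_pos one_pos)
    have h1 : Tendsto (fun r : ℝ => Real.exp (-(1 / 2 * r) + C)) atTop (𝓝 0) := by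
      refine Real.tendsto_exp_atBot.comp (tendsto_atBot_add_const_right _ _ ?_)
      exact tendsto_neg_atTop_atBot.comp (tendsto_id.const_mul_atTop (by norm_num))
    refine tendsto_of_tendsto_of_tendsto_of_le_of_le' tendsto_const_nhds h1
      (Eventually.of_forall fun _ => norm_nonneg _) ?_
    filter_upwards [eventually_gt_atTop 0] with r hr
    have h2 := norm_stretched_integrand_le (β := β) (γ := 1) (δ := 1) (a := a) (w := 1)
      (by simp) le_rfl hr
    simp only [sub_self, Real.rpow_zero, Complex.ofReal_one, one_mul] at h2 ⊢
    refine h2.trans (Real.exp_le_exp.2 ?_)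
    linarith [hC r hr]

/-! ### Differentiability of the distribution function -/

open scoped FourierTransform in
-- The inverse transform `g` is continuous and bounded. Boundedness makes small intervals have small
-- mass, so there are no atoms and the formula on open intervals extends to half-open ones;
-- continuity then allows the fundamental theorem of calculus from the arbitrary base point `x - 1`.
theorem hasDerivAt_cdf_of_integrable_charFun {ν : Measure ℝ} [IsFiniteMeasure ν]
    (hν : Integrable (charFun ν)) (x : ℝ) :
    HasDerivAt (fun y => ν.real (Set.Iic y))
      (𝓕 (fun ξ : ℝ => charFun ν (2 * Real.pi * ξ)) x).re x := by
  have hχ : Integrable (fun ξ : ℝ => charFun ν (2 * Real.pi * ξ)) :=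
    hν.comp_mul_left' (by positivity)
  have hgc : Continuous (𝓕 (fun ξ : ℝ => charFun ν (2 * Real.pi * ξ))) :=
    VectorFourier.fourierIntegral_continuous Real.continuous_fourierChar continuous_inner hχ
  have hgb : ∀ y, ‖𝓕 (fun ξ : ℝ => charFun ν (2 * Real.pi * ξ)) y‖ ≤
      ∫ ξ : ℝ, ‖charFun ν (2 * Real.pi * ξ)‖ := fun y =>
    VectorFourier.norm_fourierIntegral_le_integral_norm _ _ _ _ _
  set g := 𝓕 (fun ξ : ℝ => charFun ν (2 * Real.pi * ξ)) with hg
  set C := ∫ ξ : ℝ, ‖charFun ν (2 * Real.pi * ξ)‖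
  have hgr : Continuous fun y => (g y).re := Complex.continuous_re.comp hgc
  have hIoo : ∀ a b, ν.real (Set.Ioo a b) = ∫ y in Set.Ioo a b, (g y).re := by
    intro a b
    have h1 := congrArg Complex.re (measureReal_Ioo_eq_of_integrable_charFun hν a b)
    have h2 : IntegrableOn g (Set.Ioo a b) :=
      (hgc.integrableOn_Icc (a := a) (b := b)).mono_set Set.Ioo_subset_Icc_self
    rw [Complex.ofReal_re] at h1
    rw [h1]
    exact (integral_re (𝕜 := ℂ) h2).symm
  have hatom : ∀ y, ν.real {y} = 0 := by
    intro y
    have hle : ∀ e : ℝ, 0 < e → ν.real {y} ≤ C * (2 * e) := by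
      intro e he
      have h1 : ν.real {y} ≤ ν.real (Set.Ioo (y - e) (y + e)) :=
        measureReal_mono (by simpa using he)
      rw [hIoo] at h1
      have h2 := norm_setIntegral_le_of_norm_le_const (μ := volume)
        (s := Set.Ioo (y - e) (y + e)) (f := fun y => (g y).re) (C := C) (by simp)
        (fun z _ => (Complex.abs_re_le_norm (g z)).trans (hgb z))
      rw [Real.volume_real_Ioo_of_le (by linarith)] at h2
      calc ν.real {y} ≤ _ := h1
        _ ≤ _ := (le_abs_self _).trans h2
        _ = _ := by ring
    have hlim : Tendsto (fun e : ℝ => C * (2 * e)) (𝓝[>] 0) (𝓝 0) := by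
      have : Tendsto (fun e : ℝ => C * (2 * e)) (𝓝 0) (𝓝 (C * (2 * 0))) :=
        Continuous.tendsto (by fun_prop) _
      simpa using this.mono_left nhdsWithin_le_nhds
    refine le_antisymm (ge_of_tendsto hlim ?_) measureReal_nonneg
    filter_upwards [self_mem_nhdsWithin] with e he using hle e he
  have hcdf : ∀ y, x - 1 < y → ν.real (Set.Iic y) =
      ν.real (Set.Iic (x - 1)) + ∫ z in (x - 1)..y, (g z).re := by
    intro y hy
    have hdisj : Disjoint (Set.Iic (x - 1)) (Set.Ioc (x - 1) y) :=
      Set.disjoint_left.2 fun z hz hz' => (not_lt.2 hz) hz'.1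
    rw [intervalIntegral.integral_of_le hy.le, integral_Ioc_eq_integral_Ioo, ← hIoo,
      ← Set.Iic_union_Ioc_eq_Iic hy.le, measureReal_union hdisj measurableSet_Ioc,
      ← Set.Ioo_union_right hy,
      measureReal_union (by simp) (measurableSet_singleton y), hatom, add_zero]
  have hd := (intervalIntegral.integral_hasDerivAt_right (hgr.intervalIntegrable (x - 1) x)
    (hgr.stronglyMeasurableAtFilter _ _) hgr.continuousAt).const_add (ν.real (Set.Iic (x - 1)))
  refine hd.congr_of_eventuallyEq ?_
  filter_upwards [lt_mem_nhds (show x - 1 < x by linarith)] with y hy using hcdf y hy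

/-! ### The one-sided stable density and the Mainardi function -/

theorem Complex.ofReal_mul_I_cpow {r : ℝ} (hr : 0 < r) (s : ℝ) :
    ((r : ℂ) * Complex.I) ^ (s : ℂ) =
      Complex.exp (Real.pi * s / 2 * Complex.I) * ((r ^ s : ℝ) : ℂ) := by
  rw [Complex.cpow_def_of_ne_zero (by simp [hr.ne']), Complex.log_ofReal_mul hr Complex.I_ne_zero,
    Complex.log_I, Real.rpow_def_of_pos hr, Complex.ofReal_exp, ← Complex.exp_add]
  push_cast
  ring_nf

theorem Complex.neg_ofReal_mul_I_cpow {r : ℝ} (hr : 0 < r) (s : ℝ) :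
    (-((r : ℂ) * Complex.I)) ^ (s : ℂ) =
      Complex.exp (-(Real.pi * s / 2) * Complex.I) * ((r ^ s : ℝ) : ℂ) := by
  rw [← mul_neg, Complex.cpow_def_of_ne_zero (by simp [hr.ne']),
    Complex.log_ofReal_mul hr (by simp), Complex.log_neg_I, Real.rpow_def_of_pos hr,
    Complex.ofReal_exp, ← Complex.exp_add]
  push_cast
  ring_nf

/-- `exp (iπβ)`. -/
noncomputable def expPiMulI (β : ℝ) : ℂ := Complex.exp (Real.pi * β * Complex.I)

/-- The Mainardi function `M_β`, in Pollard's integral form. -/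
noncomputable def mainardi (β z : ℝ) : ℝ :=
  (expPiMulI β * stretchedLaplace β β (z * expPiMulI β) 1).im / Real.pi

/-- The derivative of the Mainardi function. -/
noncomputable def mainardiDeriv (β z : ℝ) : ℝ :=
  -(expPiMulI β ^ 2 * stretchedLaplace β (β + β) (z * expPiMulI β) 1).im / Real.pi

theorem hasDerivAt_im_mul_stretchedLaplace {β : ℝ} (hβ0 : 0 < β) (hβ1 : β < 1) {γ : ℝ}
    (hγ : 0 < γ) (b c : ℂ) (z : ℝ) :
    HasDerivAt (fun z : ℝ => (b * stretchedLaplace β γ (z * c) 1).im)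
      (-(b * c * stretchedLaplace β (γ + β) (z * c) 1).im) z := by
  have h1 : HasDerivAt (fun z : ℝ => (z : ℂ) * c) c z := by
    simpa using (hasDerivAt_id z).ofReal_comp.mul_const c
  have h2 := (((hasDerivAt_stretchedLaplace_left hβ0 hβ1 hγ (z * c) (w := 1) (by simp)).scomp z
    h1).const_mul b)
  have h3 := Complex.imCLM.hasFDerivAt.comp_hasDerivAt z h2
  refine HasDerivAt.congr_deriv h3 ?_
  simp only [smul_eq_mul, Complex.imCLM_apply, ← Complex.neg_im]
  congr 1
  ring

theorem hasDerivAt_mainardi {β : ℝ} (hβ0 : 0 < β) (hβ1 : β < 1) (z : ℝ) :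
    HasDerivAt (mainardi β) (mainardiDeriv β z) z := by
  refine HasDerivAt.congr_deriv ((hasDerivAt_im_mul_stretchedLaplace hβ0 hβ1 hβ0 (expPiMulI β)
    (expPiMulI β) z).div_const Real.pi) ?_
  rw [mainardiDeriv, sq]

theorem continuous_mainardiDeriv {β : ℝ} (hβ0 : 0 < β) (hβ1 : β < 1) :
    Continuous (mainardiDeriv β) := by
  have : Differentiable ℝ fun z : ℝ =>
      (expPiMulI β ^ 2 * stretchedLaplace β (β + β) (z * expPiMulI β) 1).im := fun z =>
    (hasDerivAt_im_mul_stretchedLaplace hβ0 hβ1 (add_pos hβ0 hβ0) _ _ z).differentiableAt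
  exact this.continuous.neg.div_const _

theorem continuous_mainardi {β : ℝ} (hβ0 : 0 < β) (hβ1 : β < 1) : Continuous (mainardi β) :=
  continuous_iff_continuousAt.2 fun z => (hasDerivAt_mainardi hβ0 hβ1 z).continuousAt

/-- At `z = 0` the integral is `Γ(β)`, so the value is `Γ(β) sin(πβ)/π`, which the reflection
formula evaluates. -/
theorem mainardi_zero {β : ℝ} (hβ0 : 0 < β) (hβ1 : β < 1) :
    mainardi β 0 = 1 / Real.Gamma (1 - β) := by
  have h1 : (expPiMulI β).im = Real.sin (Real.pi * β) := by
    rw [expPiMulI, ← Complex.ofReal_mul, Complex.exp_ofReal_mul_I_im]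
  have h2 := Real.Gamma_mul_Gamma_one_sub β
  have h3 : 0 < Real.sin (Real.pi * β) := Real.sin_pos_of_pos_of_lt_pi (by positivity)
    (by nlinarith [Real.pi_pos])
  have h4 : 0 < Real.Gamma (1 - β) := Real.Gamma_pos_of_pos (by linarith)
  rw [mainardi, Complex.ofReal_zero, zero_mul, stretchedLaplace_zero_left hβ0,
    Complex.im_mul_ofReal, h1, div_eq_div_iff Real.pi_pos.ne' h4.ne']
  rw [eq_div_iff h3.ne'] at h2
  linear_combination h2

theorem charFun_stable_neg {β : ℝ} {ν : Measure ℝ} [IsFiniteMeasure ν]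
    (hν0 : ∀ᵐ x ∂ν, 0 ≤ x)
    (hL : ∀ l : ℝ, 0 < l → ∫ x, Real.exp (-(l * x)) ∂ν = Real.exp (-l ^ β)) {r : ℝ}
    (hr : 0 < r) :
    charFun ν (-r) = Complex.exp (-(Complex.exp (Real.pi * β / 2 * Complex.I) *
      ((r ^ β : ℝ) : ℂ))) := by
  have e1 : -(((-r : ℝ) : ℂ) * Complex.I) = (r : ℂ) * Complex.I := by push_cast; ring
  have h := charFun_eq_of_laplace hν0 (G := fun w => Complex.exp (-w ^ (β : ℂ))) (ξ := -r)
    (fun w hw => ?_) (fun l hl => ?_) ?_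
  · rw [h, e1, Complex.ofReal_mul_I_cpow hr]
  · exact (differentiableAt_id.cpow_const (Or.inl hw)).neg.cexp.differentiableWithinAt
  · rw [hL l hl, Complex.ofReal_exp, Complex.ofReal_neg, Complex.ofReal_cpow hl.le]
  · rw [e1]
    have hs : (r : ℂ) * Complex.I ∈ Complex.slitPlane := Or.inr (by simpa using hr.ne')
    exact ((continuousAt_id.cpow continuousAt_const hs).neg).cexp

/-- This is where `β < 1` gives decay of the characteristic function: the angle `πβ/2` is below
`π/2`. -/
theorem re_exp_pi_mul_half_pos {β : ℝ} (hβ0 : 0 < β) (hβ1 : β < 1) :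
    0 < (Complex.exp (Real.pi * β / 2 * Complex.I)).re := by
  have : ((Real.pi : ℂ) * β / 2) = ((Real.pi * β / 2 : ℝ) : ℂ) := by push_cast; rfl
  rw [this, Complex.exp_ofReal_mul_I_re]
  refine Real.cos_pos_of_mem_Ioo ⟨?_, ?_⟩ <;> nlinarith [Real.pi_pos]

theorem integrable_charFun_stable {β : ℝ} (hβ0 : 0 < β) (hβ1 : β < 1) {ν : Measure ℝ}
    [IsFiniteMeasure ν] (hν0 : ∀ᵐ x ∂ν, 0 ≤ x)
    (hL : ∀ l : ℝ, 0 < l → ∫ x, Real.exp (-(l * x)) ∂ν = Real.exp (-l ^ β)) :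
    Integrable (charFun ν) := by
  have hre := re_exp_pi_mul_half_pos hβ0 hβ1
  set a := Complex.exp (Real.pi * β / 2 * Complex.I) with ha
  have h1 : IntegrableOn (fun r : ℝ => r ^ (0 : ℝ) * Real.exp (-a.re * r ^ β)) (Set.Ioi 0) :=
    integrableOn_rpow_mul_exp_neg_mul_rpow (by norm_num) hβ0 hre
  have hnorm : ∀ r : ℝ, 0 < r → ‖charFun ν (-r)‖ = r ^ (0 : ℝ) * Real.exp (-a.re * r ^ β) := by
    intro r hr
    rw [charFun_stable_neg hν0 hL hr, Complex.norm_exp, Complex.neg_re,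
      Complex.re_mul_ofReal, Real.rpow_zero, one_mul, neg_mul]
  have hneg : IntegrableOn (fun r => charFun ν (-r)) (Set.Ioi 0) := by
    refine Integrable.mono' h1 (by fun_prop) ?_
    filter_upwards [ae_restrict_mem measurableSet_Ioi] with r hr using (hnorm r hr).le
  have hpos : IntegrableOn (charFun ν) (Set.Ioi 0) := by
    refine Integrable.mono' h1 (by fun_prop) ?_
    filter_upwards [ae_restrict_mem measurableSet_Ioi] with r hr
    rw [← hnorm r hr, charFun_neg, RCLike.norm_conj]
  rw [← integrableOn_univ, ← Set.Iic_union_Ioi (a := (0 : ℝ)), integrableOn_union]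
  refine ⟨?_, hpos⟩
  have := (integrableOn_Ici_iff_integrableOn_Ioi (μ := volume) (b := (0 : ℝ))).2 hneg
  have h2 := this.comp_neg
  simpa using h2

open scoped FourierTransform in
theorem re_fourier_charFun_stable {β : ℝ} (hβ0 : 0 < β) (hβ1 : β < 1) {ν : Measure ℝ}
    [IsFiniteMeasure ν] (hν0 : ∀ᵐ x ∂ν, 0 ≤ x)
    (hL : ∀ l : ℝ, 0 < l → ∫ x, Real.exp (-(l * x)) ∂ν = Real.exp (-l ^ β)) (x : ℝ) :
    (𝓕 (fun ξ : ℝ => charFun ν (2 * Real.pi * ξ)) x).re =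
      (stretchedLaplace β 1 (Complex.exp (Real.pi * β / 2 * Complex.I))
        (-(x * Complex.I))).re / Real.pi := by
  have hint := integrable_charFun_stable hβ0 hβ1 hν0 hL
  let F : ℝ → ℂ := fun ξ => Complex.exp (-(ξ * x * Complex.I)) * charFun ν ξ
  have hF : Integrable F := by
    refine hint.bdd_mul (c := 1) (Continuous.aestronglyMeasurable (by fun_prop))
      (ae_of_all _ fun ξ => ?_)
    rw [Complex.norm_exp]
    simp
  -- Conjugate symmetry folds the inversion integral onto the negative frequencies, where the
  -- characteristic function is explicit. The resulting factor `2` turns `1/(2π)` into `1/π`.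
  have hsymm : ∀ ξ, (F ξ).re = (F (-|ξ|)).re := by
    intro ξ
    rcases le_total ξ 0 with h | h
    · rw [abs_of_nonpos h, neg_neg]
    · rw [abs_of_nonneg h]
      have : F (-ξ) = (starRingEnd ℂ) (F ξ) := by
        simp only [F, charFun_neg, map_mul, ← Complex.exp_conj, map_neg, Complex.conj_ofReal,
          Complex.conj_I]
        push_cast
        ring_nf
      rw [this, Complex.conj_re]
  have h1 : 𝓕 (fun ξ : ℝ => charFun ν (2 * Real.pi * ξ)) x = (2 * Real.pi)⁻¹ • ∫ ξ, F ξ := by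
    have := Measure.integral_comp_mul_left F (2 * Real.pi)
    rw [abs_of_pos (by positivity)] at this
    rw [← this, Real.fourier_real_eq_integral_exp_smul]
    refine integral_congr_ae (ae_of_all _ fun v => ?_)
    simp only [F, smul_eq_mul]
    push_cast
    ring_nf
  have h2 : (∫ ξ, F ξ).re = 2 * ∫ r in Set.Ioi (0 : ℝ), (F (-r)).re := by
    rw [← integral_comp_abs (f := fun r => (F (-r)).re)]
    exact (integral_re (𝕜 := ℂ) hF).symm.trans (integral_congr_ae (ae_of_all _ hsymm))
  have h3 : IntegrableOn (fun r => F (-r)) (Set.Ioi 0) := hF.comp_neg.integrableOn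
  have h4 : ∫ r in Set.Ioi (0 : ℝ), (F (-r)).re =
      (stretchedLaplace β 1 (Complex.exp (Real.pi * β / 2 * Complex.I))
        (-(x * Complex.I))).re := by
    refine (integral_re (𝕜 := ℂ) h3).trans ?_
    refine congrArg Complex.re (setIntegral_congr_fun measurableSet_Ioi fun r hr => ?_)
    simp only [F, charFun_stable_neg hν0 hL hr, ← Complex.exp_add, sub_self, Real.rpow_zero,
      Complex.ofReal_one, one_mul]
    push_cast
    ring_nf
  rw [h1, Complex.smul_re, h2, h4, smul_eq_mul]
  field_simp

theorem re_stretchedLaplace_mul_I {β : ℝ} (hβ0 : 0 < β) (hβ1 : β < 1) {x : ℝ} (hx : 0 < x) :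
    (stretchedLaplace β 1 (Complex.exp (Real.pi * β / 2 * Complex.I))
        (-(x * Complex.I))).re / Real.pi = β * x ^ (-1 - β) * mainardi β (x ^ (-β)) := by
  rw [stretchedLaplace_one_mul_I hβ0 hβ1 (re_exp_pi_mul_half_pos hβ0 hβ1) hx]
  have e1 : Complex.exp (Real.pi * β / 2 * Complex.I) * (-(x * Complex.I)) ^ (-(β : ℂ)) =
      ((x ^ (-β) : ℝ) : ℂ) * expPiMulI β := by
    have := Complex.neg_ofReal_mul_I_cpow hx (-β)
    rw [Complex.ofReal_neg] at this
    rw [this, ← mul_assoc, ← Complex.exp_add, expPiMulI, mul_comm]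
    ring_nf
  have e2 : (-(x * Complex.I) : ℂ)⁻¹ = ((x⁻¹ : ℝ) : ℂ) * Complex.I := by
    have : (x : ℂ) ≠ 0 := by exact_mod_cast hx.ne'
    rw [inv_eq_iff_eq_inv, mul_inv, Complex.inv_I]
    push_cast
    simp
  rw [e1, e2, stretchedLaplace_one_one hβ0 hβ1, mainardi]
  have e3 : x ^ (-1 - β) = x⁻¹ * x ^ (-β) := by
    rw [← Real.rpow_neg_one, ← Real.rpow_add hx]; ring_nf
  rw [e3]
  set w := expPiMulI β * stretchedLaplace β β (((x ^ (-β) : ℝ) : ℂ) * expPiMulI β) 1 with hw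
  -- The boundary term `1` from the integration by parts contributes the purely imaginary `i/x`, so
  -- only the imaginary part of `w`, that is the Mainardi function, survives in the real part.
  have e4 : (((x⁻¹ : ℝ) : ℂ) * Complex.I * (1 - (β : ℂ) * (((x ^ (-β) : ℝ) : ℂ) * expPiMulI β) *
      stretchedLaplace β β (((x ^ (-β) : ℝ) : ℂ) * expPiMulI β) 1)) =
      ((x⁻¹ : ℝ) : ℂ) * Complex.I - ((x⁻¹ * β * x ^ (-β) : ℝ) : ℂ) * (Complex.I * w) := by
    rw [hw]; push_cast; ring
  rw [e4, Complex.sub_re, Complex.re_ofReal_mul, Complex.re_ofReal_mul]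
  simp only [Complex.I_re, Complex.I_mul_re]
  ring

theorem hasDerivAt_cdf_stable {β : ℝ} (hβ0 : 0 < β) (hβ1 : β < 1) {ν : Measure ℝ}
    [IsFiniteMeasure ν] (hν0 : ∀ᵐ x ∂ν, 0 ≤ x)
    (hL : ∀ l : ℝ, 0 < l → ∫ x, Real.exp (-(l * x)) ∂ν = Real.exp (-l ^ β)) {x : ℝ}
    (hx : 0 < x) :
    HasDerivAt (fun y => ν.real (Set.Iic y)) (β * x ^ (-1 - β) * mainardi β (x ^ (-β))) x := by
  rw [← re_stretchedLaplace_mul_I hβ0 hβ1 hx, ← re_fourier_charFun_stable hβ0 hβ1 hν0 hL]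
  exact hasDerivAt_cdf_of_integrable_charFun (integrable_charFun_stable hβ0 hβ1 hν0 hL) x

/-- The inversion integrand has modulus at most `exp (-Re a r^β)`, whatever `x` is. The uniform
bound later controls `p(t,u)` as `t → 0`. -/
theorem exists_stable_density_le {β : ℝ} (hβ0 : 0 < β) (hβ1 : β < 1) :
    ∃ C, ∀ x : ℝ, 0 < x → β * x ^ (-1 - β) * mainardi β (x ^ (-β)) ≤ C := by
  have hre := re_exp_pi_mul_half_pos hβ0 hβ1
  set a := Complex.exp (Real.pi * β / 2 * Complex.I) with ha
  refine ⟨(∫ r in Set.Ioi (0 : ℝ), r ^ (0 : ℝ) * Real.exp (-a.re * r ^ β)) / Real.pi,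
    fun x hx => ?_⟩
  rw [← re_stretchedLaplace_mul_I hβ0 hβ1 hx]
  refine div_le_div_of_nonneg_right ((Complex.re_le_norm _).trans ?_) Real.pi_pos.le
  refine norm_integral_le_of_norm_le (integrableOn_rpow_mul_exp_neg_mul_rpow (by norm_num) hβ0 hre)
    ?_
  filter_upwards [ae_restrict_mem measurableSet_Ioi] with r hr
  rw [norm_mul, Complex.norm_exp, sub_self, Real.rpow_zero, Complex.ofReal_one, norm_one]
  gcongr
  have h5 : (-(-(x * Complex.I) * r) - a * (r ^ β : ℝ)).re = (-a.re) * r ^ β := by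
    rw [Complex.sub_re, Complex.re_mul_ofReal]
    simp
  rw [h5]

/-- Positivity is not visible from the integral form; it is read off from monotonicity of the
distribution function at the point `x = z^(-1/β)`, where `x^(-β) = z`. -/
theorem mainardi_nonneg {β : ℝ} (hβ0 : 0 < β) (hβ1 : β < 1) {ν : Measure ℝ}
    [IsFiniteMeasure ν] (hν0 : ∀ᵐ x ∂ν, 0 ≤ x)
    (hL : ∀ l : ℝ, 0 < l → ∫ x, Real.exp (-(l * x)) ∂ν = Real.exp (-l ^ β)) {z : ℝ}
    (hz : 0 < z) : 0 ≤ mainardi β z := by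
  have hx : 0 < z ^ (-β⁻¹) := Real.rpow_pos_of_pos hz _
  have h := (hasDerivAt_cdf_stable hβ0 hβ1 hν0 hL hx).deriv
  have hm : Monotone fun y => ν.real (Set.Iic y) := fun a b hab =>
    measureReal_mono (Set.Iic_subset_Iic.2 hab)
  have h0 : 0 ≤ deriv (fun y => ν.real (Set.Iic y)) (z ^ (-β⁻¹)) := hm.deriv_nonneg
  have h1 : (z ^ (-β⁻¹)) ^ (-β) = z := by
    rw [← Real.rpow_mul hz.le, neg_mul_neg, inv_mul_cancel₀ hβ0.ne', Real.rpow_one]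
  rw [h, h1] at h0
  exact nonneg_of_mul_nonneg_right h0 (by positivity)

/-! ### From distribution functions to densities -/

theorem measureReal_singleton_eq_zero_of_continuousAt {ν : Measure ℝ} [IsFiniteMeasure ν] {x : ℝ}
    (h : ContinuousAt (fun y => ν.real (Set.Iic y)) x) : ν.real {x} = 0 := by
  have h1 : Tendsto (fun y => ν.real (Set.Iic x) - ν.real (Set.Iic y)) (𝓝[<] x) (𝓝 0) := by
    simpa using (h.tendsto.mono_left nhdsWithin_le_nhds).const_sub (ν.real (Set.Iic x))
  refine le_antisymm (ge_of_tendsto h1 ?_) measureReal_nonneg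
  filter_upwards [self_mem_nhdsWithin] with y hy
  have hy : y < x := hy
  have h2 : ν.real {x} + ν.real (Set.Iic y) ≤ ν.real (Set.Iic x) := by
    rw [← measureReal_union (by simpa using hy) measurableSet_Iic]
    refine measureReal_mono ?_
    rintro z (rfl | hz)
    · exact le_refl z
    · exact le_trans (Set.mem_Iic.1 hz) hy.le
  linarith

/-- A nonnegative derivative on the open interval is automatically integrable once the function is
continuous up to the endpoint, and right continuity of the distribution function supplies continuity
at `0`. -/
theorem eq_withDensity_of_hasDerivAt_cdf {ν : Measure ℝ} [IsProbabilityMeasure ν] {g : ℝ → ℝ}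
    (h0 : ν (Set.Iic 0) = 0) (hg0 : ∀ x, 0 < x → 0 ≤ g x)
    (hg : ∀ x, 0 < x → HasDerivAt (fun y => ν.real (Set.Iic y)) (g x) x) :
    ν = (volume.restrict (Set.Ioi 0)).withDensity (fun x => ENNReal.ofReal (g x)) := by
  refine Measure.ext_of_Iic _ _ fun a => ?_
  rw [withDensity_apply _ measurableSet_Iic, Measure.restrict_restrict measurableSet_Iic,
    Set.Iic_inter_Ioi]
  rcases le_or_gt a 0 with ha | ha
  · rw [Set.Ioc_eq_empty (not_lt.2 ha), Measure.restrict_empty, lintegral_zero_measure]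
    exact measure_mono_null (Set.Iic_subset_Iic.2 ha) h0
  · have hcont : ContinuousOn (fun y => ν.real (Set.Iic y)) (Set.Icc 0 a) := by
      intro x hx
      rcases hx.1.eq_or_lt with rfl | hx0
      · have := (cdf ν).right_continuous 0
        rw [show ⇑(cdf ν) = fun y => ν.real (Set.Iic y) from funext (cdf_eq_real ν)] at this
        exact this.mono Set.Icc_subset_Ici_self
      · exact (hg x hx0).continuousAt.continuousWithinAt
    have hint := intervalIntegral.integrableOn_deriv_of_nonneg hcont (fun x hx => hg x hx.1)
      (fun x hx => hg0 x hx.1)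
    have hftc := intervalIntegral.integral_eq_sub_of_hasDerivAt_of_le ha.le hcont
      (fun x hx => hg x hx.1) ((intervalIntegrable_iff_integrableOn_Ioc_of_le ha.le).2 hint)
    rw [← ofReal_integral_eq_lintegral_ofReal hint, ← intervalIntegral.integral_of_le ha.le, hftc]
    · simp [measureReal_def, h0]
    · filter_upwards [ae_restrict_mem measurableSet_Ioc] with x hx using hg0 x hx.1

/-! ### The inverse process and its law -/

theorem inverseProcess_le_of_lt {Ω : Type*} {S : ℝ≥0 → Ω → ℝ} {t : ℝ} {v : ℝ≥0} {ω : Ω} (h : t < S v ω) :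
    inverseProcess S t ω ≤ v :=
  NNReal.coe_le_coe.2 (csInf_le' h)

theorem inverseProcess_le_of_neg {Ω : Type*} (S : ℝ≥0 → Ω → ℝ) (t : ℝ) {v : ℝ} (hv : v < 0) :
    {ω | inverseProcess S t ω ≤ v} = ∅ := by
  ext ω
  simp only [Set.mem_ofPred_eq, Set.mem_empty_iff_false, iff_false, not_le]
  exact hv.trans_le (NNReal.coe_nonneg _)

theorem inverseDensity_of_neg {Ω : Type*} [MeasurableSpace Ω] (P : Measure Ω)
    (S : ℝ≥0 → Ω → ℝ) (t : ℝ) {u : ℝ} (hu : u < 0) : inverseDensity P S t u = 0 := by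
  have : (fun v : ℝ => P.real {ω | inverseProcess S t ω ≤ v}) =ᶠ[𝓝 u] fun _ => 0 := by
    filter_upwards [gt_mem_nhds hu] with v hv
    rw [inverseProcess_le_of_neg S t hv, measureReal_empty]
  rw [inverseDensity, this.deriv_eq, deriv_const]

namespace IsStableSubordinator

variable {Ω : Type*} [MeasurableSpace Ω] {P : Measure Ω} {β : ℝ} {S : ℝ≥0 → Ω → ℝ}

theorem ae_nonneg (hS : IsStableSubordinator β S P) (u : ℝ≥0) : ∀ᵐ ω ∂P, 0 ≤ S u ω := by
  filter_upwards [hS.zero, hS.monotone_paths] with ω h0 hm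
  rw [← h0]
  exact hm (zero_le : (0 : ℝ≥0) ≤ u)

theorem ae_nonneg_map (hS : IsStableSubordinator β S P) (u : ℝ≥0) :
    ∀ᵐ x ∂(P.map (S u)), 0 ≤ x :=
  (ae_map_iff (hS.measurable u).aemeasurable measurableSet_Ici).2 (hS.ae_nonneg u)

theorem laplace_map (hS : IsStableSubordinator β S P) (u : ℝ≥0) {l : ℝ} (hl : 0 ≤ l) :
    ∫ x, Real.exp (-(l * x)) ∂(P.map (S u)) = Real.exp (-((u : ℝ) * l ^ β)) := by
  rw [integral_map (hS.measurable u).aemeasurable (by fun_prop), hS.laplace u l hl]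

theorem laplace_map_one (hS : IsStableSubordinator β S P) (l : ℝ) (hl : 0 < l) :
    ∫ x, Real.exp (-(l * x)) ∂(P.map (S 1)) = Real.exp (-l ^ β) := by
  simpa using hS.laplace_map 1 hl.le

variable [IsProbabilityMeasure P]

theorem isProbabilityMeasure_map (hS : IsStableSubordinator β S P) (u : ℝ≥0) :
    IsProbabilityMeasure (P.map (S u)) :=
  Measure.isProbabilityMeasure_map (hS.measurable u).aemeasurable

theorem integrable_exp_map (hS : IsStableSubordinator β S P) (u : ℝ≥0) {l : ℝ} (hl : 0 < l) :
    Integrable (fun x => Real.exp (-(l * x))) (P.map (S u)) := by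
  have := hS.isProbabilityMeasure_map u
  refine (integrable_const (1 : ℝ)).mono' (by fun_prop) ?_
  filter_upwards [hS.ae_nonneg_map u] with x hx
  rw [Real.norm_eq_abs, abs_of_pos (Real.exp_pos _), Real.exp_le_one_iff]
  nlinarith

/-- Both sides have Laplace transform `exp (-u l^β)`. -/
theorem map_eq_map_mul (hS : IsStableSubordinator β S P) (hβ0 : 0 < β) (u : ℝ≥0) :
    P.map (S u) = (P.map (S 1)).map (fun x => (u : ℝ) ^ β⁻¹ * x) := by
  have h1 := hS.isProbabilityMeasure_map 1
  have hu : 0 ≤ (u : ℝ) ^ β⁻¹ := by positivity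
  have hm : Measurable (fun x : ℝ => (u : ℝ) ^ β⁻¹ * x) := by fun_prop
  refine Measure.ext_of_laplace (fun l hl => hS.integrable_exp_map u hl) (fun l hl => ?_)
    (fun l hl => ?_)
  · rw [integrable_map_measure (by fun_prop) hm.aemeasurable]
    refine (integrable_const (1 : ℝ)).mono'
      (Continuous.aestronglyMeasurable (by simp only [Function.comp_def]; fun_prop)) ?_
    filter_upwards [hS.ae_nonneg_map 1] with x hx
    rw [Real.norm_eq_abs, Function.comp_apply, abs_of_pos (Real.exp_pos _), Real.exp_le_one_iff]
    have : 0 ≤ l * ((u : ℝ) ^ β⁻¹ * x) := by positivity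
    linarith
  · rw [integral_map hm.aemeasurable (by fun_prop), hS.laplace_map u hl.le]
    have h := hS.laplace_map 1 (mul_nonneg hl.le hu)
    simp only [← mul_assoc]
    rw [h, Real.mul_rpow hl.le hu, ← Real.rpow_mul u.coe_nonneg, inv_mul_cancel₀ hβ0.ne', Real.rpow_one]
    simp [mul_comm]

theorem cdf_map (hS : IsStableSubordinator β S P) (hβ0 : 0 < β) {u : ℝ≥0} (hu : 0 < u) (t : ℝ) :
    (P.map (S u)).real (Set.Iic t) = (P.map (S 1)).real (Set.Iic (t * (u : ℝ) ^ (-β⁻¹))) := by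
  have hu' : 0 < (u : ℝ) ^ β⁻¹ := Real.rpow_pos_of_pos hu _
  rw [hS.map_eq_map_mul hβ0, map_measureReal_apply (by fun_prop) measurableSet_Iic]
  congr 1
  ext x
  rw [Set.mem_preimage, Set.mem_Iic, Set.mem_Iic, Real.rpow_neg u.coe_nonneg, ← div_eq_mul_inv,
    le_div_iff₀ hu', mul_comm]

theorem mainardi_nonneg (hS : IsStableSubordinator β S P) (hβ0 : 0 < β) (hβ1 : β < 1) {z : ℝ}
    (hz : 0 < z) : 0 ≤ mainardi β z := by
  have := hS.isProbabilityMeasure_map 1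
  exact _root_.mainardi_nonneg hβ0 hβ1 (hS.ae_nonneg_map 1) hS.laplace_map_one hz

/-- The form of the derivative exhibits the density of `S_u` as `βu/t` times the future `p(t,u)`,
which links Laplace transforms of `S_u` to those of `p` in time. -/
theorem hasDerivAt_cdf_map (hS : IsStableSubordinator β S P) (hβ0 : 0 < β) (hβ1 : β < 1)
    {u : ℝ≥0} (hu : 0 < u) {t : ℝ} (ht : 0 < t) :
    HasDerivAt (fun t => (P.map (S u)).real (Set.Iic t))
      (β * u * (t ^ (-β) * mainardi β (u * t ^ (-β))) / t) t := by
  have := hS.isProbabilityMeasure_map 1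
  have hu0 : (0 : ℝ) < u := hu
  have hu' : 0 < (u : ℝ) ^ (-β⁻¹) := Real.rpow_pos_of_pos hu _
  have h1 := hasDerivAt_cdf_stable hβ0 hβ1 (hS.ae_nonneg_map 1) hS.laplace_map_one
    (mul_pos ht hu')
  have h2 := HasDerivAt.comp t h1 ((hasDerivAt_id t).mul_const ((u : ℝ) ^ (-β⁻¹)))
  have h3 : (fun t => (P.map (S u)).real (Set.Iic t)) = (fun y => (P.map (S 1)).real (Set.Iic y)) ∘
      fun t => id t * (u : ℝ) ^ (-β⁻¹) := funext fun t => hS.cdf_map hβ0 hu t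
  rw [h3]
  refine h2.congr_deriv ?_
  have e1 : (t * (u : ℝ) ^ (-β⁻¹)) ^ (-β) = u * t ^ (-β) := by
    rw [Real.mul_rpow ht.le hu'.le, ← Real.rpow_mul u.coe_nonneg, neg_mul_neg, inv_mul_cancel₀ hβ0.ne',
      Real.rpow_one, mul_comm]
  have e2 : (t * (u : ℝ) ^ (-β⁻¹)) ^ (-1 - β) = (t * (u : ℝ) ^ (-β⁻¹))⁻¹ * (u * t ^ (-β)) := by
    rw [← e1, ← Real.rpow_neg_one (t * (u : ℝ) ^ (-β⁻¹)), ← Real.rpow_add (by positivity)]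
    ring_nf
  rw [e1, e2]
  field_simp

theorem measure_map_Iic_zero (hS : IsStableSubordinator β S P) (hβ0 : 0 < β) (hβ1 : β < 1)
    {u : ℝ≥0} (hu : 0 < u) : P.map (S u) (Set.Iic 0) = 0 := by
  have h1 := hS.isProbabilityMeasure_map 1
  have h2 := hS.isProbabilityMeasure_map u
  have h3 : (P.map (S 1)).real {0} = 0 := measureReal_singleton_eq_zero_of_continuousAt
    (hasDerivAt_cdf_of_integrable_charFun (integrable_charFun_stable hβ0 hβ1 (hS.ae_nonneg_map 1)
      hS.laplace_map_one) 0).continuousAt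
  have h4 : (P.map (S 1)).real (Set.Iic 0) = 0 := by
    refine le_antisymm ?_ measureReal_nonneg
    refine le_trans ?_ h3.le
    refine ENNReal.toReal_mono (measure_ne_top _ _) (measure_mono_ae ?_)
    filter_upwards [hS.ae_nonneg_map 1] with x hx hx'
    exact le_antisymm hx' hx
  have h5 := hS.cdf_map hβ0 hu 0
  rw [zero_mul, h4] at h5
  exact (measureReal_eq_zero_iff).1 h5

theorem map_eq_withDensity (hS : IsStableSubordinator β S P) (hβ0 : 0 < β) (hβ1 : β < 1)
    {u : ℝ≥0} (hu : 0 < u) :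
    P.map (S u) = (volume.restrict (Set.Ioi 0)).withDensity
      (fun t => ENNReal.ofReal (β * u * (t ^ (-β) * mainardi β (u * t ^ (-β))) / t)) := by
  have := hS.isProbabilityMeasure_map u
  refine eq_withDensity_of_hasDerivAt_cdf (hS.measure_map_Iic_zero hβ0 hβ1 hu) (fun t ht => ?_)
    (fun t ht => hS.hasDerivAt_cdf_map hβ0 hβ1 hu ht)
  have hu0 : (0 : ℝ) < u := hu
  have := hS.mainardi_nonneg hβ0 hβ1 (z := u * t ^ (-β)) (by positivity)
  positivity

/-- By Markov's inequality for `exp (-S_n)`, the probability that the path stays below `t` is at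
most `exp (t - n)`. This is needed because the infimum of the empty set is `0` in `ℝ≥0`, which would
otherwise make `Z_t` vanish on bounded paths. -/
theorem ae_unbounded (hS : IsStableSubordinator β S P) (t : ℝ) :
    ∀ᵐ ω ∂P, ∃ u, t < S u ω := by
  have hle : ∀ n : ℕ, P.real {ω | ∀ u, S u ω ≤ t} ≤ Real.exp t * Real.exp (-n) := by
    intro n
    have h1 := hS.laplace n 1 zero_le_one
    rw [Real.one_rpow, mul_one] at h1
    simp only [one_mul, NNReal.coe_natCast] at h1
    have hint : Integrable (fun ω => Real.exp (-(S n ω))) P := by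
      by_contra h
      rw [integral_undef h] at h1
      exact (Real.exp_pos _).ne h1
    have h2 := mul_meas_ge_le_integral_of_nonneg (μ := P) (f := fun ω => Real.exp (-(S n ω)))
      (ae_of_all _ fun ω => (Real.exp_pos _).le) hint (Real.exp (-t))
    rw [h1] at h2
    have h3 : P.real {ω | ∀ u, S u ω ≤ t} ≤ P.real {ω | Real.exp (-t) ≤ Real.exp (-(S n ω))} :=
      measureReal_mono fun ω hω => Real.exp_le_exp.2 (neg_le_neg (hω n))
    have h4 : Real.exp t * (Real.exp (-t) * P.real {ω | Real.exp (-t) ≤ Real.exp (-(S n ω))}) ≤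
        Real.exp t * Real.exp (-n) := mul_le_mul_of_nonneg_left h2 (Real.exp_pos _).le
    rw [← mul_assoc, ← Real.exp_add, add_neg_cancel, Real.exp_zero, one_mul] at h4
    exact h3.trans h4
  have hlim : Tendsto (fun n : ℕ => Real.exp t * Real.exp (-(n : ℝ))) atTop (𝓝 0) := by
    have := (Real.tendsto_exp_neg_atTop_nhds_zero.comp tendsto_natCast_atTop_atTop).const_mul
      (Real.exp t)
    simpa using this
  have h0 : P.real {ω | ∀ u, S u ω ≤ t} = 0 :=
    le_antisymm (ge_of_tendsto' hlim hle) measureReal_nonneg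
  rw [measureReal_eq_zero_iff] at h0
  rw [ae_iff]
  simpa using h0

/-- For every `w > v` some `s < w` has `S_s > t`, so `S_w ≥ t`; right continuity lets `w` decrease
to `v`. Only the weak inequality results, and the difference `S_v = t` is null because the law of
`S_v` has no atom at `t`. -/
theorem ae_le_of_inverseProcess_le (hS : IsStableSubordinator β S P) (t : ℝ) :
    ∀ᵐ ω ∂P, ∀ v : ℝ≥0, inverseProcess S t ω ≤ v → t ≤ S v ω := by
  filter_upwards [hS.ae_unbounded t, hS.monotone_paths, hS.right_continuous_paths] with ω h1 h2 h3
    v hv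
  have hv : sInf {s : ℝ≥0 | t < S s ω} ≤ v := NNReal.coe_le_coe.1 hv
  have h4 : Tendsto (fun v => S v ω) (𝓝[>] v) (𝓝 (S v ω)) :=
    (h3 v).tendsto.mono_left (nhdsWithin_mono _ Set.Ioi_subset_Ici_self)
  refine ge_of_tendsto h4 ?_
  filter_upwards [self_mem_nhdsWithin] with w hw
  obtain ⟨s, hs, hsw⟩ := exists_lt_of_csInf_lt h1 (hv.trans_lt hw)
  exact (le_of_lt hs).trans (h2 hsw.le)

theorem inverseProcess_le_ae_eq (hS : IsStableSubordinator β S P) (hβ0 : 0 < β) (hβ1 : β < 1)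
    {t : ℝ} (ht : 0 < t) {v : ℝ≥0} (hv : 0 < v) :
    {ω | inverseProcess S t ω ≤ v} =ᵐ[P] {ω | t < S v ω} := by
  have := hS.isProbabilityMeasure_map v
  have h1 : ∀ᵐ ω ∂P, S v ω ≠ t := by
    have h2 := measureReal_singleton_eq_zero_of_continuousAt
      (hS.hasDerivAt_cdf_map hβ0 hβ1 hv ht).continuousAt
    rw [measureReal_eq_zero_iff, Measure.map_apply (hS.measurable v) (measurableSet_singleton t)]
      at h2
    rw [ae_iff]
    simpa [Set.preimage] using h2
  filter_upwards [h1, hS.ae_le_of_inverseProcess_le t] with ω h2 h3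
  refine propext ⟨fun h => lt_of_le_of_ne (h3 v h) (Ne.symm h2), fun h => ?_⟩
  exact inverseProcess_le_of_lt h

theorem inverseProcess_le_zero_null (hS : IsStableSubordinator β S P) {t : ℝ} (ht : 0 < t) :
    P {ω | inverseProcess S t ω ≤ 0} = 0 := by
  have : ∀ᵐ ω ∂P, ¬ inverseProcess S t ω ≤ 0 := by
    filter_upwards [hS.zero, hS.ae_le_of_inverseProcess_le t] with ω h0 h1 h2
    have := h1 0 (by simpa using h2)
    linarith
  rw [ae_iff] at this
  simpa using this

/-- The path properties hold only almost surely, so sublevel sets are identified with measurable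
events only up to null sets. -/
theorem aemeasurable_inverseProcess (hS : IsStableSubordinator β S P) (hβ0 : 0 < β) (hβ1 : β < 1)
    {t : ℝ} (ht : 0 < t) : AEMeasurable (inverseProcess S t) P := by
  refine NullMeasurable.aemeasurable ?_
  have h : @Measurable (NullMeasurableSpace Ω P) ℝ _ _ (inverseProcess S t) := by
    refine measurable_of_Iic fun v => ?_
    change NullMeasurableSet {ω | inverseProcess S t ω ≤ v} P
    rcases lt_trichotomy v 0 with hv | rfl | hv
    · rw [inverseProcess_le_of_neg S t hv]
      exact MeasurableSet.empty.nullMeasurableSet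
    · exact NullMeasurableSet.of_null (hS.inverseProcess_le_zero_null ht)
    · lift v to ℝ≥0 using hv.le
      refine NullMeasurableSet.congr ?_ (hS.inverseProcess_le_ae_eq hβ0 hβ1 ht hv).symm
      exact (measurableSet_lt measurable_const (hS.measurable v)).nullMeasurableSet
  exact h

theorem measureReal_inverseProcess_le (hS : IsStableSubordinator β S P) (hβ0 : 0 < β)
    (hβ1 : β < 1) {t : ℝ} (ht : 0 < t) {v : ℝ} (hv : 0 < v) :
    P.real {ω | inverseProcess S t ω ≤ v} =
      1 - (P.map (S 1)).real (Set.Iic (t * v ^ (-β⁻¹))) := by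
  lift v to ℝ≥0 using hv.le
  have := hS.isProbabilityMeasure_map v
  rw [measureReal_congr (hS.inverseProcess_le_ae_eq hβ0 hβ1 ht hv), ← hS.cdf_map hβ0 hv,
    ← probReal_compl_eq_one_sub measurableSet_Iic,
    map_measureReal_apply (hS.measurable v) measurableSet_Iic.compl]
  congr 1
  ext ω
  simp

theorem hasDerivAt_measureReal_inverseProcess_le (hS : IsStableSubordinator β S P) (hβ0 : 0 < β)
    (hβ1 : β < 1) {t : ℝ} (ht : 0 < t) {u : ℝ} (hu : 0 < u) :
    HasDerivAt (fun v : ℝ => P.real {ω | inverseProcess S t ω ≤ v})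
      (t ^ (-β) * mainardi β (u * t ^ (-β))) u := by
  have := hS.isProbabilityMeasure_map 1
  have hu' : 0 < u ^ (-β⁻¹) := Real.rpow_pos_of_pos hu _
  have h1 := hasDerivAt_cdf_stable hβ0 hβ1 (hS.ae_nonneg_map 1) hS.laplace_map_one
    (mul_pos ht hu')
  have h2 := (HasDerivAt.comp u h1
    ((Real.hasDerivAt_rpow_const (p := -β⁻¹) (Or.inl hu.ne')).const_mul t)).const_sub 1
  refine (h2.congr_deriv ?_).congr_of_eventuallyEq ?_
  · have e1 : (t * u ^ (-β⁻¹)) ^ (-β) = u * t ^ (-β) := by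
      rw [Real.mul_rpow ht.le hu'.le, ← Real.rpow_mul hu.le, neg_mul_neg, inv_mul_cancel₀ hβ0.ne',
        Real.rpow_one, mul_comm]
    have e2 : (t * u ^ (-β⁻¹)) ^ (-1 - β) = (t * u ^ (-β⁻¹))⁻¹ * (u * t ^ (-β)) := by
      rw [← e1, ← Real.rpow_neg_one (t * u ^ (-β⁻¹)), ← Real.rpow_add (by positivity)]
      ring_nf
    have e3 : u ^ (-β⁻¹ - 1) = u ^ (-β⁻¹) * u⁻¹ := by
      rw [← Real.rpow_neg_one u, ← Real.rpow_add hu]; ring_nf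
    rw [e1, e2, e3]
    field_simp
  · filter_upwards [lt_mem_nhds hu] with v hv
    exact hS.measureReal_inverseProcess_le hβ0 hβ1 ht hv

theorem inverseDensity_of_pos (hS : IsStableSubordinator β S P) (hβ0 : 0 < β)
    (hβ1 : β < 1) {t : ℝ} (ht : 0 < t) {u : ℝ} (hu : 0 < u) :
    inverseDensity P S t u = t ^ (-β) * mainardi β (u * t ^ (-β)) :=
  (hS.hasDerivAt_measureReal_inverseProcess_le hβ0 hβ1 ht hu).deriv

theorem map_inverseProcess_eq (hS : IsStableSubordinator β S P) (hβ0 : 0 < β)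
    (hβ1 : β < 1) {t : ℝ} (ht : 0 < t) :
    P.map (inverseProcess S t) = (volume.restrict (Set.Ioi 0)).withDensity
      (fun u => ENNReal.ofReal (t ^ (-β) * mainardi β (u * t ^ (-β)))) := by
  have hZ := hS.aemeasurable_inverseProcess hβ0 hβ1 ht
  have := Measure.isProbabilityMeasure_map hZ
  have hreal : (fun y => (P.map (inverseProcess S t)).real (Set.Iic y)) =
      fun v : ℝ => P.real {ω | inverseProcess S t ω ≤ v} := funext fun y => by
    rw [measureReal_def, Measure.map_apply_of_aemeasurable hZ measurableSet_Iic]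
    rfl
  refine eq_withDensity_of_hasDerivAt_cdf ?_ (fun u hu => ?_) (fun u hu => ?_)
  · rw [Measure.map_apply_of_aemeasurable hZ measurableSet_Iic]
    exact hS.inverseProcess_le_zero_null ht
  · have := hS.mainardi_nonneg hβ0 hβ1 (z := u * t ^ (-β)) (by positivity)
    positivity
  · rw [hreal]
    exact hS.hasDerivAt_measureReal_inverseProcess_le hβ0 hβ1 ht hu

end IsStableSubordinator

/-! ### Laplace transforms of convolutions and moments -/

theorem integrable_of_lintegral_ofReal_eq {ν : Measure ℝ} {f : ℝ → ℝ} (hf : Measurable f)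
    (hf0 : ∀ x, 0 ≤ f x) {m : ℝ} (hm : 0 ≤ m)
    (h : ∫⁻ x, ENNReal.ofReal (f x) ∂ν = ENNReal.ofReal m) :
    Integrable f ν ∧ ∫ x, f x ∂ν = m := by
  have h1 : Integrable f ν := by
    refine ⟨hf.aestronglyMeasurable, ?_⟩
    rw [hasFiniteIntegral_iff_ofReal (ae_of_all _ hf0), h]
    exact ENNReal.ofReal_lt_top
  refine ⟨h1, ?_⟩
  rw [integral_eq_lintegral_of_nonneg_ae (ae_of_all _ hf0) hf.aestronglyMeasurable, h,
    ENNReal.toReal_ofReal hm]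

theorem MeasureTheory.Measure.ext_of_lintegral_laplace {ν₁ ν₂ : Measure ℝ} {m : ℝ → ℝ}
    (hm : ∀ l, 0 < l → 0 ≤ m l)
    (h₁ : ∀ l, 0 < l → ∫⁻ x, ENNReal.ofReal (Real.exp (-(l * x))) ∂ν₁ = ENNReal.ofReal (m l))
    (h₂ : ∀ l, 0 < l → ∫⁻ x, ENNReal.ofReal (Real.exp (-(l * x))) ∂ν₂ = ENNReal.ofReal (m l)) :
    ν₁ = ν₂ := by
  have k₁ := fun l hl => integrable_of_lintegral_ofReal_eq (by fun_prop)
    (fun x => (Real.exp_pos _).le) (hm l hl) (h₁ l hl)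
  have k₂ := fun l hl => integrable_of_lintegral_ofReal_eq (by fun_prop)
    (fun x => (Real.exp_pos _).le) (hm l hl) (h₂ l hl)
  exact Measure.ext_of_laplace (fun l hl => (k₁ l hl).1) (fun l hl => (k₂ l hl).1)
    fun l hl => (k₁ l hl).2.trans (k₂ l hl).2.symm

/-- The Laplace transform turns convolution into multiplication. -/
theorem lintegral_exp_mul_convolution {K q : ℝ → ENNReal} (hK : Measurable K) (hq : Measurable q)
    (l : ℝ) :
    ∫⁻ t, ENNReal.ofReal (Real.exp (-(l * t))) * ∫⁻ r, K r * q (t - r) =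
      (∫⁻ r, ENNReal.ofReal (Real.exp (-(l * r))) * K r) *
        ∫⁻ s, ENNReal.ofReal (Real.exp (-(l * s))) * q s := by
  have hE : Measurable fun t : ℝ => ENNReal.ofReal (Real.exp (-(l * t))) := by fun_prop
  calc ∫⁻ t, ENNReal.ofReal (Real.exp (-(l * t))) * ∫⁻ r, K r * q (t - r)
      = ∫⁻ t, ∫⁻ r, ENNReal.ofReal (Real.exp (-(l * t))) * (K r * q (t - r)) := by
        refine lintegral_congr fun t => ?_
        rw [lintegral_const_mul _ (by fun_prop)]
    _ = ∫⁻ r, ∫⁻ t, ENNReal.ofReal (Real.exp (-(l * t))) * (K r * q (t - r)) :=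
        lintegral_lintegral_swap (by fun_prop)
    _ = ∫⁻ r, ENNReal.ofReal (Real.exp (-(l * r))) * K r *
          ∫⁻ s, ENNReal.ofReal (Real.exp (-(l * s))) * q s := by
        refine lintegral_congr fun r => ?_
        rw [← lintegral_const_mul _ (by fun_prop), ← lintegral_sub_right_eq_self (fun s =>
          ENNReal.ofReal (Real.exp (-(l * r))) * K r *
            (ENNReal.ofReal (Real.exp (-(l * s))) * q s)) r]
        refine lintegral_congr fun t => ?_
        have : Real.exp (-(l * t)) = Real.exp (-(l * r)) * Real.exp (-(l * (t - r))) := by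
          rw [← Real.exp_add]; ring_nf
        rw [this, ENNReal.ofReal_mul (Real.exp_pos _).le]
        ring
    _ = _ := lintegral_mul_const _ (by fun_prop)

theorem lintegral_exp_mul_rpow {a l : ℝ} (ha : 0 < a) (hl : 0 < l) :
    ∫⁻ r in Set.Ioi (0 : ℝ), ENNReal.ofReal (r ^ (a - 1) * Real.exp (-(l * r))) =
      ENNReal.ofReal (l ^ (-a) * Real.Gamma a) := by
  have h1 := integrableOn_rpow_mul_exp_neg_mul_rpow (p := 1) (s := a - 1) (b := l)
    (by linarith) one_pos hl
  simp only [Real.rpow_one, neg_mul] at h1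
  rw [← ofReal_integral_eq_lintegral_ofReal h1, Real.integral_rpow_mul_exp_neg_mul_Ioi ha hl,
    one_div, Real.inv_rpow hl.le, Real.rpow_neg hl.le]
  filter_upwards [ae_restrict_mem measurableSet_Ioi] with r hr
  have := Real.rpow_nonneg (le_of_lt hr) (a - 1)
  positivity

namespace IsStableSubordinator

variable {Ω : Type*} [MeasurableSpace Ω] {P : Measure Ω} {β : ℝ} {S : ℝ≥0 → Ω → ℝ}
  [IsProbabilityMeasure P]

theorem integrable_pow_mul_exp_map (hS : IsStableSubordinator β S P) (u : ℝ≥0) {l : ℝ}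
    (hl : 0 < l) (n : ℕ) :
    Integrable (fun x => x ^ n * Real.exp (-(l * x))) (P.map (S u)) := by
  have := integrable_pow_mul_exp_of_mem_interior_integrableExpSet (X := id) (v := -l)
    (mem_interior_integrableExpSet_of_neg (fun l hl => hS.integrable_exp_map u hl)
      (by linarith)) n
  simpa using this

theorem hasDerivAt_integral_pow_mul_exp_map (hS : IsStableSubordinator β S P) (u : ℝ≥0) {l : ℝ}
    (hl : 0 < l) (n : ℕ) :
    HasDerivAt (fun l => ∫ x, x ^ n * Real.exp (-(l * x)) ∂(P.map (S u)))
      (-∫ x, x ^ (n + 1) * Real.exp (-(l * x)) ∂(P.map (S u))) l := by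
  have h1 := hasDerivAt_integral_pow_mul_exp_real (X := id) (t := -l)
    (mem_interior_integrableExpSet_of_neg (fun l hl => hS.integrable_exp_map u hl)
      (by linarith)) n
  have h2 := h1.comp l (hasDerivAt_neg l)
  simp only [Function.comp_def, id, neg_mul, mul_neg, mul_one] at h2
  exact h2

/-- Obtained, like the second moment below, by differentiating `E[exp (-l S_u)] = exp (-u l^β)` in
`l`. -/
theorem integral_mul_exp_map (hS : IsStableSubordinator β S P) (u : ℝ≥0) {l : ℝ} (hl : 0 < l) :
    ∫ x, x ^ 1 * Real.exp (-(l * x)) ∂(P.map (S u)) =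
      u * β * l ^ (β - 1) * Real.exp (-(u * l ^ β)) := by
  have h1 := hS.hasDerivAt_integral_pow_mul_exp_map u hl 0
  have h2 := ((((Real.hasDerivAt_rpow_const (p := β) (Or.inl hl.ne')).const_mul (u : ℝ)).neg).exp)
  have h3 : (fun l => ∫ x, x ^ 0 * Real.exp (-(l * x)) ∂(P.map (S u))) =ᶠ[𝓝 l]
      fun l => Real.exp (-(u * l ^ β)) := by
    filter_upwards [lt_mem_nhds hl] with l hl
    simp only [pow_zero, one_mul]
    exact hS.laplace_map u hl.le
  have h4 := (h1.congr_of_eventuallyEq h3.symm).unique h2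
  simp only [Pi.neg_apply] at h4
  rw [zero_add] at h4
  linear_combination -h4

theorem integral_sq_mul_exp_map (hS : IsStableSubordinator β S P) (u : ℝ≥0) {l : ℝ}
    (hl : 0 < l) :
    ∫ x, x ^ 2 * Real.exp (-(l * x)) ∂(P.map (S u)) =
      (u * β * (1 - β) * l ^ (β - 2) + (u * β * l ^ (β - 1)) ^ 2) *
        Real.exp (-(u * l ^ β)) := by
  have h1 := hS.hasDerivAt_integral_pow_mul_exp_map u hl 1
  have h2 := ((((Real.hasDerivAt_rpow_const (p := β) (Or.inl hl.ne')).const_mul (u : ℝ)).neg).exp)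
  have h5 := ((Real.hasDerivAt_rpow_const (x := l) (p := β - 1) (Or.inl hl.ne')).const_mul
    ((u : ℝ) * β)).mul h2
  have h3 : (fun l => ∫ x, x ^ 1 * Real.exp (-(l * x)) ∂(P.map (S u))) =ᶠ[𝓝 l]
      fun l => u * β * l ^ (β - 1) * Real.exp (-(u * l ^ β)) := by
    filter_upwards [lt_mem_nhds hl] with l hl using hS.integral_mul_exp_map u hl
  have h4 := (h1.congr_of_eventuallyEq h3.symm).unique h5
  simp only [Pi.neg_apply] at h4
  rw [show β - 1 - 1 = β - 2 by ring] at h4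
  linear_combination -h4

theorem lintegral_pow_mul_exp_map (hS : IsStableSubordinator β S P) (u : ℝ≥0) {l : ℝ}
    (hl : 0 < l) (n : ℕ) :
    ∫⁻ x, ENNReal.ofReal (x ^ n * Real.exp (-(l * x))) ∂(P.map (S u)) =
      ENNReal.ofReal (∫ x, x ^ n * Real.exp (-(l * x)) ∂(P.map (S u))) := by
  rw [ofReal_integral_eq_lintegral_ofReal (hS.integrable_pow_mul_exp_map u hl n)]
  filter_upwards [hS.ae_nonneg_map u] with x hx
  positivity

end IsStableSubordinator

/-! ### The density as a function of time and its convolution equation -/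

/-- The density `t^(-β) M_β(u t^(-β))` of the inverse stable subordinator at time `t > 0`,
extended by zero to `t ≤ 0`. -/
noncomputable def scaledMainardi (β u t : ℝ) : ℝ :=
  (Set.Ioi (0 : ℝ)).indicator (fun t => t ^ (-β) * mainardi β (u * t ^ (-β))) t

theorem scaledMainardi_of_pos (β u : ℝ) {t : ℝ} (ht : 0 < t) :
    scaledMainardi β u t = t ^ (-β) * mainardi β (u * t ^ (-β)) :=
  Set.indicator_of_mem (Set.mem_Ioi.2 ht) _

theorem scaledMainardi_of_nonpos (β u : ℝ) {t : ℝ} (ht : t ≤ 0) : scaledMainardi β u t = 0 :=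
  Set.indicator_of_notMem (by simpa using ht) _

/-- Since `βu p(t,u)/t` is the density of `S_u`, which is bounded, `p(t,u)` is `O(t)` at `0`. This
makes the extension by zero continuous. -/
theorem exists_scaledMainardi_le {β : ℝ} (hβ0 : 0 < β) (hβ1 : β < 1) {u : ℝ} (hu : 0 < u) :
    ∃ C, 0 ≤ C ∧ ∀ t, 0 < t → scaledMainardi β u t ≤ C * t := by
  obtain ⟨C, hC⟩ := exists_stable_density_le hβ0 hβ1
  have hu' : 0 < u ^ (-β⁻¹) := Real.rpow_pos_of_pos hu _
  refine ⟨max C 0 * u ^ (-β⁻¹) / (β * u), by positivity, fun t ht => ?_⟩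
  have h := hC _ (mul_pos ht hu')
  have e1 : (t * u ^ (-β⁻¹)) ^ (-β) = u * t ^ (-β) := by
    rw [Real.mul_rpow ht.le hu'.le, ← Real.rpow_mul hu.le, neg_mul_neg, inv_mul_cancel₀ hβ0.ne',
      Real.rpow_one, mul_comm]
  have e2 : (t * u ^ (-β⁻¹)) ^ (-1 - β) = (t * u ^ (-β⁻¹))⁻¹ * (u * t ^ (-β)) := by
    rw [← e1, ← Real.rpow_neg_one (t * u ^ (-β⁻¹)), ← Real.rpow_add (by positivity)]
    ring_nf
  rw [e1, e2] at h
  have e3 : β * ((t * u ^ (-β⁻¹))⁻¹ * (u * t ^ (-β))) * mainardi β (u * t ^ (-β)) =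
      scaledMainardi β u t * (β * u) / (t * u ^ (-β⁻¹)) := by
    rw [scaledMainardi_of_pos β u ht]
    field_simp
  rw [e3, div_le_iff₀ (by positivity)] at h
  rw [div_mul_eq_mul_div, le_div_iff₀ (by positivity)]
  refine h.trans ?_
  rw [mul_assoc, mul_comm (u ^ (-β⁻¹)) t]
  exact mul_le_mul_of_nonneg_right (le_max_left _ _) (by positivity)

/-- The derivative is arranged to contain `p` itself, for the cancellation in
`hasDerivAt_rlIntegral_scaledMainardi`. -/
theorem hasDerivAt_scaledMainardi {β : ℝ} (hβ0 : 0 < β) (hβ1 : β < 1) (u : ℝ) {t : ℝ}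
    (ht : 0 < t) :
    HasDerivAt (scaledMainardi β u)
      (-(β / t) * (scaledMainardi β u t +
        u * (t ^ (-(2 * β)) * mainardiDeriv β (u * t ^ (-β))))) t := by
  have h1 : HasDerivAt (fun t : ℝ => t ^ (-β)) (-β * t ^ (-β - 1)) t :=
    Real.hasDerivAt_rpow_const (Or.inl ht.ne')
  have h2 := (hasDerivAt_mainardi hβ0 hβ1 (u * t ^ (-β))).comp t (h1.const_mul u)
  have h3 := h1.mul h2
  refine (h3.congr_deriv ?_).congr_of_eventuallyEq ?_
  · have e1 : t ^ (-β - 1) = t ^ (-β) / t := by rw [Real.rpow_sub ht, Real.rpow_one]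
    have e2 : t ^ (-(2 * β)) = t ^ (-β) * t ^ (-β) := by rw [← Real.rpow_add ht]; ring_nf
    rw [scaledMainardi_of_pos β u ht, e1, e2]
    simp only [Function.comp_apply]
    field_simp
    ring
  · filter_upwards [lt_mem_nhds ht] with s hs using scaledMainardi_of_pos β u hs

namespace IsStableSubordinator

variable {Ω : Type*} [MeasurableSpace Ω] {P : Measure Ω} {β : ℝ} {S : ℝ≥0 → Ω → ℝ}
  [IsProbabilityMeasure P]

theorem scaledMainardi_nonneg (hS : IsStableSubordinator β S P) (hβ0 : 0 < β) (hβ1 : β < 1)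
    {u : ℝ} (hu : 0 < u) (t : ℝ) : 0 ≤ scaledMainardi β u t := by
  rcases le_or_gt t 0 with ht | ht
  · rw [scaledMainardi_of_nonpos β u ht]
  · rw [scaledMainardi_of_pos β u ht]
    have := hS.mainardi_nonneg hβ0 hβ1 (z := u * t ^ (-β)) (by positivity)
    positivity

theorem continuous_scaledMainardi (hS : IsStableSubordinator β S P) (hβ0 : 0 < β) (hβ1 : β < 1)
    {u : ℝ} (hu : 0 < u) : Continuous (scaledMainardi β u) := by
  rw [continuous_iff_continuousAt]
  intro t
  rcases lt_trichotomy t 0 with ht | rfl | ht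
  · have : scaledMainardi β u =ᶠ[𝓝 t] fun _ => 0 := by
      filter_upwards [gt_mem_nhds ht] with s hs using scaledMainardi_of_nonpos β u hs.le
    exact continuousAt_const.congr this.symm
  · obtain ⟨C, hC0, hC⟩ := exists_scaledMainardi_le hβ0 hβ1 hu
    rw [ContinuousAt, scaledMainardi_of_nonpos β u le_rfl]
    have h1 : Tendsto (fun t : ℝ => C * |t|) (𝓝 0) (𝓝 0) := by
      have : Continuous fun t : ℝ => C * |t| := by fun_prop
      simpa using this.tendsto 0
    refine squeeze_zero (fun t => hS.scaledMainardi_nonneg hβ0 hβ1 hu t) (fun t => ?_) h1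
    rcases le_or_gt t 0 with ht | ht
    · rw [scaledMainardi_of_nonpos β u ht]; positivity
    · rw [abs_of_pos ht]; exact hC t ht
  · exact (hasDerivAt_scaledMainardi hβ0 hβ1 u ht).continuousAt

theorem lintegral_pow_mul_exp_mul_scaledMainardi (hS : IsStableSubordinator β S P) (hβ0 : 0 < β)
    (hβ1 : β < 1) {u : ℝ≥0} (hu : 0 < u) {l : ℝ} (hl : 0 < l) (n : ℕ) :
    ∫⁻ s, ENNReal.ofReal (Real.exp (-(l * s))) * ENNReal.ofReal (s ^ n * scaledMainardi β u s) =
      ENNReal.ofReal ((∫ x, x ^ (n + 1) * Real.exp (-(l * x)) ∂(P.map (S u))) / (β * u)) := by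
  have hu0 : (0 : ℝ) < u := hu
  have hM := (continuous_mainardi hβ0 hβ1).measurable
  rw [div_eq_inv_mul, ENNReal.ofReal_mul (by positivity), ← hS.lintegral_pow_mul_exp_map u hl,
    hS.map_eq_withDensity hβ0 hβ1 hu,
    lintegral_withDensity_eq_lintegral_mul _ (by fun_prop) (by fun_prop),
    ← lintegral_const_mul _ (by fun_prop), ← lintegral_indicator measurableSet_Ioi]
  refine lintegral_congr fun s => ?_
  rcases le_or_gt s 0 with hs | hs
  · rw [Set.indicator_of_notMem (by simpa using hs), scaledMainardi_of_nonpos β u hs]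
    simp
  · have h0 := hS.scaledMainardi_nonneg hβ0 hβ1 hu0 s
    rw [Set.indicator_of_mem (Set.mem_Ioi.2 hs), ← ENNReal.ofReal_mul (Real.exp_pos _).le,
      Pi.mul_apply, ← scaledMainardi_of_pos β u hs, ← ENNReal.ofReal_mul (by positivity),
      ← ENNReal.ofReal_mul (by positivity)]
    congr 1
    field_simp
    ring

/-- With `c = (1-β)/(βu)`, the kernel has transform `l^(β-1) + c/l` and `p` has transform `l^(β-1)
exp (-u l^β)`. The product is the transform of `t p/(βu)`, given by the second moment of `S_u`.
Uniqueness yields equality for almost every `t`, and continuity upgrades it to every `t > 0`. -/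
theorem convolution_eq (hS : IsStableSubordinator β S P) (hβ0 : 0 < β) (hβ1 : β < 1) {u : ℝ}
    (hu : 0 < u) {t : ℝ} (ht : 0 < t) :
    ∫ r in (0 : ℝ)..t, scaledMainardi β u (t - r) *
        (r ^ (-β) / Real.Gamma (1 - β) + (1 - β) / (β * u)) =
      t * scaledMainardi β u t / (β * u) := by
  have hΓ : 0 < Real.Gamma (1 - β) := Real.Gamma_pos_of_pos (by linarith)
  have hβ' : 0 < 1 - β := by linarith
  obtain ⟨v, hvu⟩ : ∃ v : ℝ≥0, (v : ℝ) = u := ⟨⟨u, hu.le⟩, rfl⟩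
  have hv : 0 < v := by rw [← NNReal.coe_pos, hvu]; exact hu
  set c := (1 - β) / (β * u) with hc
  have hc0 : 0 ≤ c := by positivity
  set w := scaledMainardi β u with hw
  have hwc : Continuous w := hS.continuous_scaledMainardi hβ0 hβ1 hu
  have hw0 : ∀ t, 0 ≤ w t := hS.scaledMainardi_nonneg hβ0 hβ1 hu
  set k : ℝ → ℝ := fun r => r ^ (-β) / Real.Gamma (1 - β) + c with hk
  have hk0 : ∀ r, 0 < r → 0 ≤ k r := fun r hr => by
    have := Real.rpow_nonneg hr.le (-β)
    positivity
  have hkm : Measurable k := by fun_prop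
  have hkint : ∀ a b, IntervalIntegrable k volume a b := fun a b =>
    ((intervalIntegral.intervalIntegrable_rpow' (by linarith)).div_const _).add
      intervalIntegrable_const
  let K : ℝ → ENNReal := (Set.Ioi (0 : ℝ)).indicator fun r => ENNReal.ofReal (k r)
  let q : ℝ → ENNReal := fun s => ENNReal.ofReal (w s)
  have hK : Measurable K := Measurable.indicator (by fun_prop) measurableSet_Ioi
  have hq : Measurable q := hwc.measurable.ennreal_ofReal
  -- The integral over the whole line is the one over `(0, t)`, because `K` vanishes for `r ≤ 0` and
  -- `q (t - r)` for `r ≥ t`.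
  let J : ℝ → ENNReal := fun t => ∫⁻ r, K r * q (t - r)
  have hJ : Measurable J := by
    have : Measurable fun p : ℝ × ℝ => K p.2 * q (p.1 - p.2) := by fun_prop
    exact this.lintegral_prod_right'
  let m : ℝ → ℝ := fun l => (l ^ (β - 1) + c * l⁻¹) * (l ^ (β - 1) * Real.exp (-(u * l ^ β)))
  have hm : ∀ l, 0 < l → 0 ≤ m l := fun l hl => by positivity
  have hKl : ∀ l, 0 < l → ∫⁻ r, ENNReal.ofReal (Real.exp (-(l * r))) * K r =
      ENNReal.ofReal (l ^ (β - 1) + c * l⁻¹) := by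
    intro l hl
    have e1 : ∫⁻ r, ENNReal.ofReal (Real.exp (-(l * r))) * K r =
        ∫⁻ r in Set.Ioi (0 : ℝ),
          (ENNReal.ofReal (Real.Gamma (1 - β))⁻¹ *
              ENNReal.ofReal (r ^ ((1 - β) - 1) * Real.exp (-(l * r))) +
            ENNReal.ofReal c * ENNReal.ofReal (r ^ ((1 : ℝ) - 1) * Real.exp (-(l * r)))) := by
      rw [← lintegral_indicator measurableSet_Ioi]
      refine lintegral_congr fun r => ?_
      rcases le_or_gt r 0 with hr | hr
      · simp [K, hr]
      · have h1 := Real.rpow_nonneg hr.le (-β)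
        have h2 := hk0 r hr
        simp only [K, Set.indicator_of_mem (Set.mem_Ioi.2 hr)]
        rw [show (1 - β) - 1 = -β by ring, sub_self, Real.rpow_zero,
          ← ENNReal.ofReal_mul (by positivity), ← ENNReal.ofReal_mul (by positivity),
          ← ENNReal.ofReal_mul (by positivity), ← ENNReal.ofReal_add (by positivity)
          (by positivity)]
        congr 1
        simp only [k]
        ring
    rw [e1, lintegral_add_left (by fun_prop), lintegral_const_mul _ (by fun_prop),
      lintegral_const_mul _ (by fun_prop), lintegral_exp_mul_rpow hβ' hl,
      lintegral_exp_mul_rpow one_pos hl, Real.Gamma_one, ← ENNReal.ofReal_mul (by positivity),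
      ← ENNReal.ofReal_mul (by positivity), ← ENNReal.ofReal_add (by positivity)
      (by positivity), Real.rpow_neg_one, neg_sub]
    congr 1
    field_simp
  have hql : ∀ l, 0 < l → ∫⁻ s, ENNReal.ofReal (Real.exp (-(l * s))) * q s =
      ENNReal.ofReal (l ^ (β - 1) * Real.exp (-(u * l ^ β))) := by
    intro l hl
    have h := hS.lintegral_pow_mul_exp_mul_scaledMainardi hβ0 hβ1 hv hl 0
    simp only [pow_zero, one_mul, zero_add] at h
    have h2 := hS.integral_mul_exp_map v hl
    rw [hvu] at h h2
    rw [h2] at h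
    refine h.trans ?_
    congr 1
    field_simp
  have hright : ∀ l, 0 < l → ∫⁻ s, ENNReal.ofReal (Real.exp (-(l * s))) *
      ENNReal.ofReal (s * w s / (β * u)) = ENNReal.ofReal (m l) := by
    intro l hl
    have h := hS.lintegral_pow_mul_exp_mul_scaledMainardi hβ0 hβ1 hv hl 1
    have h2 := hS.integral_sq_mul_exp_map v hl
    rw [hvu] at h h2
    rw [show 1 + 1 = 2 by rfl, h2] at h
    simp only [pow_one] at h
    have e1 : ∀ s, ENNReal.ofReal (Real.exp (-(l * s))) * ENNReal.ofReal (s * w s / (β * u)) =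
        ENNReal.ofReal (β * u)⁻¹ *
          (ENNReal.ofReal (Real.exp (-(l * s))) * ENNReal.ofReal (s * w s)) := by
      intro s
      rw [div_eq_inv_mul, ENNReal.ofReal_mul (by positivity)]
      ring
    simp only [e1]
    rw [lintegral_const_mul _ (by fun_prop), h, ← ENNReal.ofReal_mul (by positivity)]
    congr 1
    have e2 : l ^ (β - 2) = l⁻¹ * l ^ (β - 1) := by
      rw [← Real.rpow_neg_one l, ← Real.rpow_add hl]; ring_nf
    simp only [m, hc]
    rw [e2]
    field_simp
    ring
  have hmeas : volume.withDensity J =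
      volume.withDensity fun t => ENNReal.ofReal (t * w t / (β * u)) := by
    refine Measure.ext_of_lintegral_laplace hm (fun l hl => ?_) (fun l hl => ?_)
    · rw [lintegral_withDensity_eq_lintegral_mul _ hJ (by fun_prop)]
      simp only [Pi.mul_apply, mul_comm (J _)]
      rw [lintegral_exp_mul_convolution hK hq, hKl l hl, hql l hl,
        ← ENNReal.ofReal_mul (by positivity)]
    · rw [lintegral_withDensity_eq_lintegral_mul _ (by fun_prop) (by fun_prop)]
      simp only [Pi.mul_apply, mul_comm (ENNReal.ofReal (_ * w _ / _))]
      exact hright l hl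
  have hae := (withDensity_eq_iff_of_sigmaFinite hJ.aemeasurable
    (by fun_prop : Measurable _).aemeasurable).1 hmeas
  have hcint : ∀ t b, IntervalIntegrable (fun r => w (t - r) * k r) volume 0 b := fun t b =>
    (hkint 0 b).continuousOn_mul (by fun_prop)
  have hJt : ∀ t, 0 < t → J t = ENNReal.ofReal (∫ r in (0 : ℝ)..t, w (t - r) * k r) := by
    intro t ht
    rw [intervalIntegral.integral_of_le ht.le, ofReal_integral_eq_lintegral_ofReal
      ((intervalIntegrable_iff_integrableOn_Ioc_of_le ht.le).1 (hcint t t)) ?_,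
      ← lintegral_indicator measurableSet_Ioc]
    · refine lintegral_congr fun r => ?_
      by_cases hr : r ∈ Set.Ioc 0 t
      · simp only [K, q, Set.indicator_of_mem hr, Set.indicator_of_mem (Set.mem_Ioi.2 hr.1)]
        rw [mul_comm, ENNReal.ofReal_mul (hw0 _)]
      · rw [Set.indicator_of_notMem hr]
        rw [Set.mem_Ioc, not_and_or, not_lt, not_le] at hr
        rcases hr with hr | hr
        · simp [K, hr]
        · simp only [q, hw]
          rw [scaledMainardi_of_nonpos β u (by linarith), ENNReal.ofReal_zero, mul_zero]
    · filter_upwards [ae_restrict_mem measurableSet_Ioc] with r hr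
      exact mul_nonneg (hw0 _) (hk0 r hr.1)
  have hae' : (fun t => ∫ r in (0 : ℝ)..t, w (t - r) * k r)
      =ᵐ[volume.restrict (Set.Ioi 0)] fun t => t * w t / (β * u) := by
    filter_upwards [ae_restrict_of_ae hae, ae_restrict_mem measurableSet_Ioi] with t h1 h2
    have h2 : 0 < t := h2
    rw [hJt t h2] at h1
    have h3 := hw0 t
    refine (ENNReal.ofReal_eq_ofReal_iff ?_ (by positivity)).1 h1
    exact intervalIntegral.integral_nonneg_of_ae_restrict h2.le (by
      filter_upwards [ae_restrict_mem measurableSet_Icc, ae_restrict_of_ae (Measure.ae_ne volume 0)]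
        with r hr hr0
      exact mul_nonneg (hw0 _) (hk0 r (lt_of_le_of_ne hr.1 (Ne.symm hr0))))
  refine Measure.eqOn_open_of_ae_eq hae' isOpen_Ioi ?_ (by fun_prop) ht
  intro t0 ht0
  have ht0 : 0 < t0 := ht0
  refine ContinuousAt.continuousWithinAt ?_
  obtain ⟨B, hB⟩ := (isCompact_Icc (a := -(t0 + 1)) (b := t0 + 1)).exists_bound_of_continuousOn
    hwc.continuousOn
  -- The upper limit is frozen at `t0 + 1`, which changes nothing since `w (t - r) = 0` for `r ≥ t`;
  -- then only the integrand depends on `t` and dominated convergence applies.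
  have hcont : ContinuousAt (fun t => ∫ r in (0 : ℝ)..(t0 + 1), w (t - r) * k r) t0 := by
    refine intervalIntegral.continuousAt_of_dominated_interval (bound := fun r => B * |k r|) ?_ ?_
      ((hkint _ _).abs.const_mul B) ?_
    · exact Eventually.of_forall fun t => by
        exact ((hwc.measurable.comp (by fun_prop)).mul hkm).aestronglyMeasurable
    · filter_upwards [Ioo_mem_nhds ht0 (show t0 < t0 + 1 by linarith)] with t ht
      refine ae_of_all _ fun r hr => ?_
      rw [Set.uIoc_of_le (by linarith)] at hr
      rw [norm_mul, Real.norm_eq_abs (k r)]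
      refine mul_le_mul_of_nonneg_right (hB _ ⟨?_, ?_⟩) (abs_nonneg _)
      · linarith [hr.2, ht.1]
      · linarith [hr.1, ht.2]
    · exact ae_of_all _ fun r _ => by fun_prop
  refine hcont.congr ?_
  filter_upwards [Ioo_mem_nhds ht0 (show t0 < t0 + 1 by linarith)] with t ht
  rw [← intervalIntegral.integral_add_adjacent_intervals (hcint t t)
    ((hcint t t).symm.trans (hcint t (t0 + 1)))]
  rw [add_eq_left, intervalIntegral.integral_of_le ht.2.le]
  refine setIntegral_eq_zero_of_forall_eq_zero fun r hr => ?_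
  rw [hw, scaledMainardi_of_nonpos β u (by linarith [hr.1]), zero_mul]

end IsStableSubordinator

/-! ### The candidate fractional derivative and integration by parts in `u` -/

/-- The Riemann–Liouville derivative of order `β` in time of the density
`t^(-β) M_β(u t^(-β))`. -/
noncomputable def fracDerivMainardi (β u t : ℝ) : ℝ :=
  -(t ^ (-(2 * β)) * mainardiDeriv β (u * t ^ (-β)))

theorem measurable_uncurry_scaledMainardi {β : ℝ} (hβ0 : 0 < β) (hβ1 : β < 1) :
    Measurable fun p : ℝ × ℝ => scaledMainardi β p.1 p.2 := by
  have hM := (continuous_mainardi hβ0 hβ1).measurable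
  have h1 : Measurable fun p : ℝ × ℝ => p.2 ^ (-β) * mainardi β (p.1 * p.2 ^ (-β)) := by fun_prop
  exact h1.indicator (measurableSet_lt measurable_const measurable_snd :
    MeasurableSet {p : ℝ × ℝ | 0 < p.2})

theorem measurable_scaledMainardi_left {β : ℝ} (hβ0 : 0 < β) (hβ1 : β < 1) (t : ℝ) :
    Measurable fun u => scaledMainardi β u t := by
  have h := (measurable_uncurry_scaledMainardi hβ0 hβ1).comp
    (measurable_id.prodMk (measurable_const (a := t)))
  simp only [Function.comp_def, id] at h
  exact h

theorem continuousOn_fracDerivMainardi {β : ℝ} (hβ0 : 0 < β) (hβ1 : β < 1) :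
    ContinuousOn (fun p : ℝ × ℝ => fracDerivMainardi β p.2 p.1) (Set.Ioi 0 ×ˢ Set.univ) := by
  have hM := continuous_mainardiDeriv hβ0 hβ1
  have h : ∀ s : ℝ, ContinuousOn (fun p : ℝ × ℝ => p.1 ^ s) (Set.Ioi 0 ×ˢ Set.univ) := fun s =>
    continuousOn_fst.rpow_const fun p hp => Or.inl (ne_of_gt hp.1)
  exact ((h _).mul (hM.comp_continuousOn (continuousOn_snd.mul (h _)))).neg

theorem continuous_fracDerivMainardi {β : ℝ} (hβ0 : 0 < β) (hβ1 : β < 1) (t : ℝ) :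
    Continuous (fun u => fracDerivMainardi β u t) := by
  have := continuous_mainardiDeriv hβ0 hβ1
  unfold fracDerivMainardi
  fun_prop

/-- Integration by parts in `u`, the boundary term at `0` being `t^(-β) / Γ(1-β)`. -/
theorem integral_fracDerivMainardi_mul_sub {β : ℝ} (hβ0 : 0 < β) (hβ1 : β < 1) {t : ℝ}
    (ht : 0 < t) {φ : ℝ → ℝ} (hφ : IsTestFunction φ) :
    (∫ u in Set.Ioi 0, fracDerivMainardi β u t * φ u) -
      ∫ u in Set.Ioi 0, scaledMainardi β u t * deriv φ u =
      t ^ (-β) / Real.Gamma (1 - β) * φ 0 := by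
  obtain ⟨hφs, hφc⟩ := hφ
  have hφ' : Continuous (deriv φ) := hφs.continuous_deriv (by simp)
  have hD := continuous_fracDerivMainardi hβ0 hβ1 t
  have hw : (fun u => scaledMainardi β u t) = fun u => t ^ (-β) * mainardi β (u * t ^ (-β)) :=
    funext fun u => scaledMainardi_of_pos β u ht
  have hwc : Continuous fun u => scaledMainardi β u t := by
    rw [hw]
    have := continuous_mainardi hβ0 hβ1
    fun_prop
  have hwd : ∀ u, HasDerivAt (fun u => scaledMainardi β u t) (-fracDerivMainardi β u t) u := by
    intro u
    have h2 := (((hasDerivAt_mainardi hβ0 hβ1 (u * t ^ (-β))).comp u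
      ((hasDerivAt_id u).mul_const (t ^ (-β)))).const_mul (t ^ (-β)))
    rw [hw]
    refine h2.congr_deriv ?_
    have e2 : t ^ (-(2 * β)) = t ^ (-β) * t ^ (-β) := by rw [← Real.rpow_add ht]; ring_nf
    rw [fracDerivMainardi, e2]
    ring
  have i1 : Integrable fun u => fracDerivMainardi β u t * φ u :=
    (hD.mul hφs.continuous).integrable_of_hasCompactSupport hφc.mul_left
  have i2 : Integrable fun u => scaledMainardi β u t * deriv φ u :=
    (hwc.mul hφ').integrable_of_hasCompactSupport hφc.deriv.mul_left
  have hf : ∀ u ∈ Set.Ici (0 : ℝ), HasDerivAt (fun u => scaledMainardi β u t * φ u)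
      (-(fracDerivMainardi β u t * φ u) + scaledMainardi β u t * deriv φ u) u := fun u _ =>
    ((hwd u).mul ((hφs.differentiable (by simp)) u).hasDerivAt).congr_deriv (by ring)
  have hlim : Tendsto (fun u => scaledMainardi β u t * φ u) atTop (𝓝 0) :=
    (hφc.mul_left (f := fun u => scaledMainardi β u t)).is_zero_at_infty.mono_left
      atTop_le_cocompact
  have key := integral_Ioi_of_hasDerivAt_of_tendsto' hf
    (i1.neg.add i2).integrableOn hlim
  rw [integral_add (f := fun u => -(fracDerivMainardi β u t * φ u)) i1.neg.integrableOn
    i2.integrableOn, integral_neg, scaledMainardi_of_pos β 0 ht, zero_mul,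
    mainardi_zero hβ0 hβ1] at key
  linear_combination -key

/-! ### Fractional derivatives of the density and of its pairings -/

namespace IsStableSubordinator

variable {Ω : Type*} [MeasurableSpace Ω] {P : Measure Ω} {β : ℝ} {S : ℝ≥0 → Ω → ℝ}
  [IsProbabilityMeasure P]

theorem inverseDensity_eq_scaledMainardi (hS : IsStableSubordinator β S P) (hβ0 : 0 < β)
    (hβ1 : β < 1) {t : ℝ} (ht : 0 < t) {u : ℝ} (hu : 0 < u) :
    inverseDensity P S t u = scaledMainardi β u t := by
  rw [hS.inverseDensity_of_pos hβ0 hβ1 ht hu, scaledMainardi_of_pos β u ht]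

theorem inverseDensity_mul_ae_eq (hS : IsStableSubordinator β S P) (hβ0 : 0 < β)
    (hβ1 : β < 1) {t : ℝ} (ht : 0 < t) (φ : ℝ → ℝ) :
    (fun u => inverseDensity P S t u * φ u) =ᵐ[volume]
      (Set.Ioi 0).indicator fun u => scaledMainardi β u t * φ u := by
  filter_upwards [Measure.ae_ne volume (0 : ℝ)] with u hu
  rcases lt_or_gt_of_ne hu with h | h
  · rw [inverseDensity_of_neg P S t h, Set.indicator_of_notMem (by simpa using h.le), zero_mul]
  · rw [Set.indicator_of_mem (Set.mem_Ioi.2 h), hS.inverseDensity_eq_scaledMainardi hβ0 hβ1 ht h]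

theorem integral_inverseDensity_mul (hS : IsStableSubordinator β S P) (hβ0 : 0 < β)
    (hβ1 : β < 1) {t : ℝ} (ht : 0 < t) (φ : ℝ → ℝ) :
    ∫ u, inverseDensity P S t u * φ u = ∫ u in Set.Ioi 0, scaledMainardi β u t * φ u := by
  rw [integral_congr_ae (hS.inverseDensity_mul_ae_eq hβ0 hβ1 ht φ),
    integral_indicator measurableSet_Ioi]

theorem map_inverseProcess_eq_withDensity (hS : IsStableSubordinator β S P) (hβ0 : 0 < β)
    (hβ1 : β < 1) {t : ℝ} (ht : 0 < t) :
    P.map (inverseProcess S t) =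
      volume.withDensity (fun u => ENNReal.ofReal (inverseDensity P S t u)) := by
  have h := hS.inverseDensity_mul_ae_eq hβ0 hβ1 ht 1
  rw [hS.map_inverseProcess_eq hβ0 hβ1 ht, ← withDensity_indicator measurableSet_Ioi]
  refine withDensity_congr_ae ?_
  filter_upwards [h] with u hu
  simp only [Pi.one_apply, mul_one] at hu
  rw [hu]
  by_cases h0 : u ∈ Set.Ioi (0 : ℝ)
  · simp only [Set.indicator_of_mem h0, scaledMainardi_of_pos β u ht]
  · simp only [Set.indicator_of_notMem h0, ENNReal.ofReal_zero]

/-- The total mass is `1` because this is the density of the probability law of `Z_t`; no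
computation with `M` is needed. -/
theorem integrable_scaledMainardi (hS : IsStableSubordinator β S P) (hβ0 : 0 < β)
    (hβ1 : β < 1) {t : ℝ} (ht : 0 < t) :
    IntegrableOn (fun u => scaledMainardi β u t) (Set.Ioi 0) ∧
      ∫ u in Set.Ioi 0, scaledMainardi β u t = 1 := by
  have hZ := hS.aemeasurable_inverseProcess hβ0 hβ1 ht
  have := Measure.isProbabilityMeasure_map hZ
  have h1 := measure_univ (μ := P.map (inverseProcess S t))
  rw [hS.map_inverseProcess_eq hβ0 hβ1 ht, withDensity_apply _ MeasurableSet.univ,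
    Measure.restrict_univ] at h1
  simp only [← scaledMainardi_of_pos β _ ht] at h1
  have h0 : ∀ᵐ u ∂(volume.restrict (Set.Ioi (0 : ℝ))), 0 ≤ scaledMainardi β u t := by
    filter_upwards [ae_restrict_mem measurableSet_Ioi] with u hu
    exact hS.scaledMainardi_nonneg hβ0 hβ1 hu t
  have hm := measurable_scaledMainardi_left hβ0 hβ1 t
  refine ⟨⟨hm.aestronglyMeasurable, ?_⟩, ?_⟩
  · rw [hasFiniteIntegral_iff_ofReal h0, h1]
    exact ENNReal.one_lt_top
  · rw [integral_eq_lintegral_of_nonneg_ae h0 hm.aestronglyMeasurable, h1, ENNReal.toReal_one]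

theorem intervalIntegrable_scaledMainardi_mul_rpow (hS : IsStableSubordinator β S P)
    (hβ0 : 0 < β) (hβ1 : β < 1) {u : ℝ} (hu : 0 < u) (t a b : ℝ) :
    IntervalIntegrable (fun r => scaledMainardi β u (t - r) * r ^ (-β)) volume a b := by
  have := hS.continuous_scaledMainardi hβ0 hβ1 hu
  exact (intervalIntegral.intervalIntegrable_rpow' (by linarith)).continuousOn_mul (by fun_prop)

/-- The singular kernel disappears: the right side involves only `p` and its ordinary primitive, so
it can be differentiated directly. -/
theorem rlIntegral_scaledMainardi (hS : IsStableSubordinator β S P)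
    (hβ0 : 0 < β) (hβ1 : β < 1) {u : ℝ} (hu : 0 < u) {t : ℝ} (ht : 0 < t) :
    rlIntegral β (scaledMainardi β u) t = t * scaledMainardi β u t / (β * u) -
      (1 - β) / (β * u) * ∫ s in (0 : ℝ)..t, scaledMainardi β u s := by
  have hc := hS.continuous_scaledMainardi hβ0 hβ1 hu
  have h := hS.convolution_eq hβ0 hβ1 hu ht
  have e : ∀ r : ℝ, scaledMainardi β u (t - r) *
      (r ^ (-β) / Real.Gamma (1 - β) + (1 - β) / (β * u)) =
      1 / Real.Gamma (1 - β) * (scaledMainardi β u (t - r) * r ^ (-β)) +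
        (1 - β) / (β * u) * scaledMainardi β u (t - r) := fun r => by ring
  simp only [e] at h
  rw [intervalIntegral.integral_add
    ((hS.intervalIntegrable_scaledMainardi_mul_rpow hβ0 hβ1 hu t 0 t).const_mul _)
    (Continuous.intervalIntegrable (by fun_prop) _ _), intervalIntegral.integral_const_mul,
    intervalIntegral.integral_const_mul,
    intervalIntegral.integral_comp_sub_left (fun s => scaledMainardi β u s), sub_self,
    sub_zero] at h
  rw [rlIntegral]
  linear_combination h

theorem hasDerivAt_rlIntegral_scaledMainardi (hS : IsStableSubordinator β S P)
    (hβ0 : 0 < β) (hβ1 : β < 1) {u : ℝ} (hu : 0 < u) {t : ℝ} (ht : 0 < t) :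
    HasDerivAt (rlIntegral β (scaledMainardi β u)) (fracDerivMainardi β u t) t := by
  have hc := hS.continuous_scaledMainardi hβ0 hβ1 hu
  have h1 := (((hasDerivAt_id t).mul (hasDerivAt_scaledMainardi hβ0 hβ1 u ht)).div_const
    (β * u)).sub ((intervalIntegral.integral_hasDerivAt_right (hc.intervalIntegrable 0 t)
      (hc.stronglyMeasurableAtFilter _ _) hc.continuousAt).const_mul ((1 - β) / (β * u)))
  refine (h1.congr_deriv ?_).congr_of_eventuallyEq ?_
  · rw [fracDerivMainardi]
    simp only [id]
    field_simp
    ring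
  · filter_upwards [lt_mem_nhds ht] with s hs using hS.rlIntegral_scaledMainardi hβ0 hβ1 hu hs

theorem rl_inverseDensity (hS : IsStableSubordinator β S P)
    (hβ0 : 0 < β) (hβ1 : β < 1) {u : ℝ} (hu : 0 < u) {t : ℝ} (ht : 0 < t) :
    (∀ᶠ s in 𝓝 t,
      IntervalIntegrable (fun r => inverseDensity P S (s - r) u * r ^ (-β)) volume 0 s) ∧
    HasDerivAt (rlIntegral β (fun s => inverseDensity P S s u)) (fracDerivMainardi β u t) t := by
  -- Restricting to the open interval avoids `r = s`, where `p(0, u)` enters and the formula for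
  -- positive times is not available.
  have hae : ∀ s, 0 < s → ∀ r ∈ Set.Ioo 0 s, inverseDensity P S (s - r) u * r ^ (-β) =
      scaledMainardi β u (s - r) * r ^ (-β) := fun s hs r hr => by
    rw [hS.inverseDensity_eq_scaledMainardi hβ0 hβ1 (by linarith [hr.2]) hu]
  refine ⟨?_, (hS.hasDerivAt_rlIntegral_scaledMainardi hβ0 hβ1 hu ht).congr_of_eventuallyEq ?_⟩
  · filter_upwards [lt_mem_nhds ht] with s hs
    have h1 := hS.intervalIntegrable_scaledMainardi_mul_rpow hβ0 hβ1 hu s 0 s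
    rw [intervalIntegrable_iff_integrableOn_Ioo_of_le hs.le] at h1 ⊢
    exact h1.congr_fun (fun r hr => (hae s hs r hr).symm) measurableSet_Ioo
  · filter_upwards [lt_mem_nhds ht] with s hs
    rw [rlIntegral, rlIntegral, intervalIntegral.integral_of_le hs.le,
      intervalIntegral.integral_of_le hs.le, integral_Ioc_eq_integral_Ioo,
      integral_Ioc_eq_integral_Ioo, setIntegral_congr_fun measurableSet_Ioo (hae s hs)]

theorem rlDeriv_inverseDensity_ae_eq (hS : IsStableSubordinator β S P)
    (hβ0 : 0 < β) (hβ1 : β < 1) {t : ℝ} (ht : 0 < t) :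
    (fun u => rlDeriv β (fun s => inverseDensity P S s u) t) =ᵐ[volume]
      (Set.Ioi 0).indicator fun u => fracDerivMainardi β u t := by
  filter_upwards [Measure.ae_ne volume (0 : ℝ)] with u hu
  rcases lt_or_gt_of_ne hu with h | h
  · rw [Set.indicator_of_notMem (by simpa using h.le)]
    have : rlIntegral β (fun s => inverseDensity P S s u) = fun _ => 0 := by
      funext s
      simp only [rlIntegral, inverseDensity_of_neg P S _ h, zero_mul,
        intervalIntegral.integral_zero, mul_zero]
    rw [rlDeriv, this, deriv_const]
  · rw [Set.indicator_of_mem (Set.mem_Ioi.2 h)]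
    exact (hS.rl_inverseDensity hβ0 hβ1 h ht).2.deriv

/-- With `B` a bound for `φ`, the integral over `u` is at most `B r^(-β)` since `p(s - r, ·)` has
mass `1`, and `β < 1` makes this integrable at `0`. -/
theorem integrable_prod_scaledMainardi_mul (hS : IsStableSubordinator β S P)
    (hβ0 : 0 < β) (hβ1 : β < 1) {φ : ℝ → ℝ} (hφ : IsTestFunction φ) {s : ℝ} (hs : 0 < s) :
    Integrable (fun p : ℝ × ℝ => scaledMainardi β p.2 (s - p.1) * φ p.2 * p.1 ^ (-β))
      ((volume.restrict (Set.Ioo 0 s)).prod (volume.restrict (Set.Ioi 0))) := by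
  obtain ⟨hφs, hφc⟩ := hφ
  have hφm := hφs.continuous.measurable
  obtain ⟨B, hB⟩ := hφs.continuous.bounded_above_of_compact_support hφc
  have hm : Measurable fun p : ℝ × ℝ => scaledMainardi β p.2 (s - p.1) := by
    have h := (measurable_uncurry_scaledMainardi hβ0 hβ1).comp
      ((measurable_snd (α := ℝ) (β := ℝ)).prodMk (measurable_fst.const_sub s))
    simp only [Function.comp_def] at h
    exact h
  have hF : Measurable fun p : ℝ × ℝ => scaledMainardi β p.2 (s - p.1) * φ p.2 * p.1 ^ (-β) := by
    fun_prop
  have hrint : IntegrableOn (fun r : ℝ => B * r ^ (-β)) (Set.Ioo 0 s) :=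
    ((intervalIntegrable_iff_integrableOn_Ioo_of_le hs.le).1
      (intervalIntegral.intervalIntegrable_rpow' (by linarith))).const_mul B
  rw [integrable_prod_iff hF.aestronglyMeasurable]
  have hbound : ∀ r ∈ Set.Ioo 0 s, ∀ u ∈ Set.Ioi (0 : ℝ),
      ‖scaledMainardi β u (s - r) * φ u * r ^ (-β)‖ ≤
        B * r ^ (-β) * scaledMainardi β u (s - r) := by
    intro r hr u hu
    have h1 := hS.scaledMainardi_nonneg hβ0 hβ1 hu (s - r)
    have h2 := Real.rpow_nonneg hr.1.le (-β)
    rw [norm_mul, norm_mul, Real.norm_of_nonneg h1, Real.norm_of_nonneg h2]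
    calc scaledMainardi β u (s - r) * ‖φ u‖ * r ^ (-β)
        ≤ scaledMainardi β u (s - r) * B * r ^ (-β) := by gcongr; exact hB u
      _ = _ := by ring
  have hint : ∀ r ∈ Set.Ioo 0 s, IntegrableOn
      (fun u => B * r ^ (-β) * scaledMainardi β u (s - r)) (Set.Ioi 0) := fun r hr =>
    (hS.integrable_scaledMainardi hβ0 hβ1 (by linarith [hr.2])).1.const_mul _
  constructor
  · filter_upwards [ae_restrict_mem measurableSet_Ioo] with r hr
    refine (hint r hr).mono' (hF.comp measurable_prodMk_left).aestronglyMeasurable ?_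
    filter_upwards [ae_restrict_mem measurableSet_Ioi] with u hu using hbound r hr u hu
  · refine hrint.mono' hF.aestronglyMeasurable.norm.integral_prod_right' ?_
    filter_upwards [ae_restrict_mem measurableSet_Ioo] with r hr
    rw [Real.norm_of_nonneg (integral_nonneg fun _ => norm_nonneg _)]
    calc ∫ u in Set.Ioi 0, ‖scaledMainardi β u (s - r) * φ u * r ^ (-β)‖
        ≤ ∫ u in Set.Ioi 0, B * r ^ (-β) * scaledMainardi β u (s - r) := by
          refine integral_mono_of_nonneg (ae_of_all _ fun _ => norm_nonneg _) (hint r hr) ?_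
          filter_upwards [ae_restrict_mem measurableSet_Ioi] with u hu using hbound r hr u hu
      _ = B * r ^ (-β) := by
          rw [integral_const_mul,
            (hS.integrable_scaledMainardi hβ0 hβ1 (by linarith [hr.2])).2, mul_one]

/-- The fractional integral commutes with the pairing against a test function. -/
theorem rlIntegral_pairing (hS : IsStableSubordinator β S P)
    (hβ0 : 0 < β) (hβ1 : β < 1) {φ : ℝ → ℝ} (hφ : IsTestFunction φ) {s : ℝ} (hs : 0 < s) :
    IntervalIntegrable (fun r => (∫ u, inverseDensity P S (s - r) u * φ u) * r ^ (-β))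
      volume 0 s ∧
    IntegrableOn (fun u => rlIntegral β (scaledMainardi β u) s * φ u) (Set.Ioi 0) ∧
    rlIntegral β (fun s => ∫ u, inverseDensity P S s u * φ u) s =
      ∫ u in Set.Ioi 0, rlIntegral β (scaledMainardi β u) s * φ u := by
  have hint := hS.integrable_prod_scaledMainardi_mul hβ0 hβ1 hφ hs
  have e1 : ∀ r ∈ Set.Ioo 0 s, ∫ u in Set.Ioi 0, scaledMainardi β u (s - r) * φ u * r ^ (-β) =
      (∫ u, inverseDensity P S (s - r) u * φ u) * r ^ (-β) := fun r hr => by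
    rw [integral_mul_const, hS.integral_inverseDensity_mul hβ0 hβ1 (by linarith [hr.2])]
  have e2 : ∀ u, 1 / Real.Gamma (1 - β) * ∫ r in Set.Ioo 0 s,
      scaledMainardi β u (s - r) * φ u * r ^ (-β) =
      rlIntegral β (scaledMainardi β u) s * φ u := fun u => by
    rw [rlIntegral, intervalIntegral.integral_of_le hs.le, integral_Ioc_eq_integral_Ioo, mul_assoc,
      ← integral_mul_const]
    congr 1
    refine integral_congr_ae (ae_of_all _ fun r => ?_)
    ring
  refine ⟨?_, ?_, ?_⟩
  · rw [intervalIntegrable_iff_integrableOn_Ioo_of_le hs.le]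
    exact IntegrableOn.congr_fun hint.integral_prod_left e1 measurableSet_Ioo
  · have := hint.integral_prod_right.const_mul (1 / Real.Gamma (1 - β))
    simp only [e2] at this
    exact this
  · rw [rlIntegral, intervalIntegral.integral_of_le hs.le, integral_Ioc_eq_integral_Ioo,
      ← setIntegral_congr_fun measurableSet_Ioo e1, integral_integral_swap hint,
      ← integral_const_mul]
    simp only [e2]

theorem hasDerivAt_rlIntegral_pairing (hS : IsStableSubordinator β S P)
    (hβ0 : 0 < β) (hβ1 : β < 1) {φ : ℝ → ℝ} (hφ : IsTestFunction φ) {t : ℝ} (ht : 0 < t) :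
    HasDerivAt (rlIntegral β (fun s => ∫ u, inverseDensity P S s u * φ u))
      (∫ u in Set.Ioi 0, fracDerivMainardi β u t * φ u) t := by
  have hφc := hφ.1.continuous
  -- The candidate derivative is continuous for `s > 0` and all real `u`, including `u = 0`, so it
  -- is bounded on this compact set of times and support points of `φ`; `B ‖φ u‖` then dominates.
  obtain ⟨B, hB⟩ := ((isCompact_Icc (a := t / 2) (b := 3 * t / 2)).prod
    hφ.2.isCompact).exists_bound_of_continuousOn
      ((continuousOn_fracDerivMainardi hβ0 hβ1).mono (Set.prod_mono
        (fun s hs => lt_of_lt_of_le (half_pos ht) hs.1) (Set.subset_univ _)))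
  have hball : ∀ s ∈ Metric.ball t (t / 2), s ∈ Set.Icc (t / 2) (3 * t / 2) := by
    intro s hs
    rw [Real.ball_eq_Ioo] at hs
    exact ⟨by linarith [hs.1], by linarith [hs.2]⟩
  have key := hasDerivAt_integral_of_dominated_loc_of_deriv_le
    (μ := volume.restrict (Set.Ioi (0 : ℝ))) (𝕜 := ℝ) (x₀ := t) (s := Metric.ball t (t / 2))
    (F := fun s u => rlIntegral β (scaledMainardi β u) s * φ u)
    (F' := fun s u => fracDerivMainardi β u s * φ u)
    (bound := fun u => B * ‖φ u‖) (Metric.ball_mem_nhds t (half_pos ht)) ?_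
    (hS.rlIntegral_pairing hβ0 hβ1 hφ ht).2.1 ?_ ?_ ?_ ?_
  · refine key.2.congr_of_eventuallyEq ?_
    filter_upwards [lt_mem_nhds ht] with s hs using (hS.rlIntegral_pairing hβ0 hβ1 hφ hs).2.2
  · filter_upwards [lt_mem_nhds ht] with s hs
    exact (hS.rlIntegral_pairing hβ0 hβ1 hφ hs).2.1.aestronglyMeasurable
  · exact ((continuous_fracDerivMainardi hβ0 hβ1 t).mul hφc).aestronglyMeasurable
  · refine ae_of_all _ fun u s hs => ?_
    by_cases hu : u ∈ tsupport φ
    · rw [norm_mul]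
      exact mul_le_mul_of_nonneg_right (hB (s, u) ⟨hball s hs, hu⟩) (norm_nonneg _)
    · rw [image_eq_zero_of_notMem_tsupport hu, mul_zero, norm_zero, mul_zero]
  · exact ((hφc.integrable_of_hasCompactSupport hφ.2).norm.const_mul B).integrableOn
  · filter_upwards [ae_restrict_mem measurableSet_Ioi] with u hu s hs
    have hs' : 0 < s := lt_of_lt_of_le (half_pos ht) (hball s hs).1
    exact (hS.hasDerivAt_rlIntegral_scaledMainardi hβ0 hβ1 hu hs').mul_const _

end IsStableSubordinator

/-! ### The governing equation -/

theorem mainTheorem6 {Ω : Type*} [MeasurableSpace Ω] (P : Measure Ω) [IsProbabilityMeasure P]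
    (β : ℝ) (hβ0 : 0 < β) (hβ1 : β < 1) (S : ℝ≥0 → Ω → ℝ) (hS : IsStableSubordinator β S P)
    (t : ℝ) (ht : 0 < t) :
    -- `p(t, ·)` is a genuine derivative on `u > 0` and is the density of `Z_t`
    (∀ u : ℝ, 0 < u →
      DifferentiableAt ℝ (fun v : ℝ => P.real {ω | inverseProcess S t ω ≤ v}) u) ∧
    AEMeasurable (inverseProcess S t) P ∧
    P.map (inverseProcess S t) =
      volume.withDensity (fun u => ENNReal.ofReal (inverseDensity P S t u)) ∧
    -- `D_t^β p(t, u)` exists for every `u > 0` and is locally integrable in `u`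
    (∀ u : ℝ, 0 < u → RLDifferentiableAt β (fun s => inverseDensity P S s u) t) ∧
    LocallyIntegrable (fun u => rlDeriv β (fun s => inverseDensity P S s u) t) volume ∧
    -- the equation between distributions in `u`, with `D_t^β p(t, ·)` taken for each fixed `u`
    (∀ φ : ℝ → ℝ, IsTestFunction φ →
      (∫ u, rlDeriv β (fun s => inverseDensity P S s u) t * φ u)
          - ∫ u, inverseDensity P S t u * deriv φ u
        = t ^ (-β) / Real.Gamma (1 - β) * φ 0) ∧
    -- the same equation, with `D_t^β` applied to the distribution-valued map `s ↦ p(s, ·)`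
    (∀ φ : ℝ → ℝ, IsTestFunction φ →
      RLDifferentiableAt β (fun s => ∫ u, inverseDensity P S s u * φ u) t ∧
      rlDeriv β (fun s => ∫ u, inverseDensity P S s u * φ u) t
          - ∫ u, inverseDensity P S t u * deriv φ u
        = t ^ (-β) / Real.Gamma (1 - β) * φ 0) := by
  -- Both forms of the equation reduce to the same integral over `u > 0`; the values at `u = 0` form
  -- a null set.
  have h2 : ∀ φ : ℝ → ℝ, (∫ u, rlDeriv β (fun s => inverseDensity P S s u) t * φ u) =
      ∫ u in Set.Ioi 0, fracDerivMainardi β u t * φ u := fun φ => by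
    rw [← integral_indicator measurableSet_Ioi]
    refine integral_congr_ae ?_
    filter_upwards [hS.rlDeriv_inverseDensity_ae_eq hβ0 hβ1 ht] with u hu
    rw [hu]
    exact (Set.indicator_mul_left _ _ _).symm
  refine ⟨fun u hu => (hS.hasDerivAt_measureReal_inverseProcess_le hβ0 hβ1 ht hu).differentiableAt,
    hS.aemeasurable_inverseProcess hβ0 hβ1 ht, hS.map_inverseProcess_eq_withDensity hβ0 hβ1 ht,
    fun u hu => ?_, ?_, fun φ hφ => ?_, fun φ hφ => ⟨⟨?_, ?_⟩, ?_⟩⟩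
  · have h := hS.rl_inverseDensity hβ0 hβ1 hu ht
    exact ⟨h.1, h.2.differentiableAt⟩
  · refine LocallyIntegrable.congr ?_ (hS.rlDeriv_inverseDensity_ae_eq hβ0 hβ1 ht).symm
    exact (continuous_fracDerivMainardi hβ0 hβ1 t).locallyIntegrable.indicator measurableSet_Ioi
  · rw [h2, hS.integral_inverseDensity_mul hβ0 hβ1 ht,
      integral_fracDerivMainardi_mul_sub hβ0 hβ1 ht hφ]
  · filter_upwards [lt_mem_nhds ht] with s hs using (hS.rlIntegral_pairing hβ0 hβ1 hφ hs).1
  · exact (hS.hasDerivAt_rlIntegral_pairing hβ0 hβ1 hφ ht).differentiableAt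
  · rw [rlDeriv, (hS.hasDerivAt_rlIntegral_pairing hβ0 hβ1 hφ ht).deriv,
      hS.integral_inverseDensity_mul hβ0 hβ1 ht,
      integral_fracDerivMainardi_mul_sub hβ0 hβ1 ht hφ]
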